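/- Let $d\ge 1$ be an integer and let $q\in\mathbb C\setminus\{0\}$. Let $\mathcal F_n\cong\mathbb Z^n\rtimes B_n$ be the framed braid group on $n$ strands, generated by $\sigma_1,\dots,\sigma_{n-1}$ and $t_1,\dots,t_n$ with the relations $\sigma_i\sigma_j\sigma_i=\sigma_j\sigma_i\sigma_j$ for $|i-j|=1$, $\sigma_i\sigma_j=\sigma_j\sigma_i$ for $|i-j|>1$, $t_it_j=t_jt_i$, and $t_j\sigma_i=\sigma_it_{s_i(j)}$, where $s_i=(i,i+1)$. Let $\mathcal F_{d,n}$ be the quotient of $\mathcal F_n$ by the relations $t_j^d=1$. Put $e_i=\frac1d\sum_{s=1}^{d}t_i^st_{i+1}^{-s}\in\mathbb C\mathcal F_{d,n}$. The Yokonuma--Hecke algebra $\mathrm Y_{d,n}(q)$ is the quotient of $\mathbb C\mathcal F_{d,n}$ by the two-sided ideal generated by the elements $\sigma_i^2-1-(q-q^{-1})e_i\sigma_i$, $1\le i\le n-1$; write $g_i$ for the image of $\sigma_i$. Let $X_D=(\mathrm x_1,\dots,\mathrm x_{d-1})$ be a complex solution of the $\mathrm E$-system $E^{(m)}=\mathrm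 x_mE^{(0)}$ ($1\le m\le d-1$), where $E^{(m)}=\frac1d\sum_{s=0}^{d-1}\mathrm x_{m+s}\mathrm x_{d-s}$, with indices modulo $d$ and $\mathrm x_0=1$ (such solutions are parametrized by the non-empty subsets $D$ of $\mathbb Z/d\mathbb Z$). The specialized trace $\mathrm{tr}_{d,D}$ is the unique linear map from $\bigcup_n\mathrm Y_{d,n}(q)$ to $\mathbb C[z]$ such that, for all $n$, $\mathrm{tr}_{d,D}(ab)=\mathrm{tr}_{d,D}(ba)$ for $a,b\in \mathrm Y_{d,n}(q)$; $\mathrm{tr}_{d,D}(1)=1$; $\mathrm{tr}_{d,D}(ag_n)=z\,\mathrm{tr}_{d,D}(a)$ for $n\ge1$ and $a\in \mathrm Y_{d,n}(q)$; and $\mathrm{tr}_{d,D}(at_{n+1}^s)=\mathrm x_s\,\mathrm{tr}_{d,D}(a)$ for $a\in \mathrm Y_{d,n}(q)$ and $1\le s\le d-1$. For a framed braid $\alpha\in\mathcal F_n$, $\mathrm{tr}_{d,D}(\alpha)$ denotes the trace of the image of $\alpha$ in $\mathrm Y_{d,n}(q)$. For $n,m\ge1$, $\alpha\in\mathcal F_n$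 and $\beta\in\mathcal F_m$, the connected sum $\alpha\#\beta\in\mathcal F_{n+m-1}$ is the product $\alpha^{[0]}\beta^{[n-1]}$, where $\alpha^{[0]}$ is the image of $\alpha$ under $\sigma_i\mapsto\sigma_i$, $t_j\mapsto t_j$, and $\beta^{[n-1]}$ is the image of $\beta$ under $\sigma_i\mapsto\sigma_{n+i-1}$, $t_j\mapsto t_{n+j-1}$. **Proposition.** For all $n,m\ge1$, the following are equivalent: 1. $\mathrm{tr}_{d,D}(\alpha\#\beta)=\mathrm{tr}_{d,D}(\alpha)\,\mathrm{tr}_{d,D}(\beta)$ for all $\alpha\in\mathcal F_n$ and $\beta\in\mathcal F_m$; 2. $\mathrm x_1^d=1$ and $\mathrm x_k=\mathrm x_1^k$ for all $k=1,\dots,d-1$. -/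

import Mathlib

set_option linter.unusedSectionVars false
set_option linter.unusedSimpArgs false

noncomputable section

namespace YokonumaHecke

/-! ### Framed braid groups -/

/-- Generators of the framed braid group on `n` strands, with strands numbered from `0`:
`sigma i` crosses the strands `i` and `i + 1`, and `t j` is the framing `1` on the strand `j`. -/
inductive FramedGen (n : ℕ) : Type
  | sigma (i : ℕ) (hi : i + 1 < n) : FramedGen n
  | t (j : Fin n) : FramedGen n

/-- The generator `sigma i`, in the free group. -/
def freeSigma {n : ℕ} (i : ℕ) (hi : i + 1 < n) : FreeGroup (FramedGen n) :=
  FreeGroup.of (.sigma i hi)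

/-- The generator `t j`, in the free group. -/
def freeT {n : ℕ} (j : Fin n) : FreeGroup (FramedGen n) := FreeGroup.of (.t j)

/-- The transposition `(i, i + 1)` of the strands. -/
def strandSwap {n : ℕ} (i : ℕ) (hi : i + 1 < n) : Equiv.Perm (Fin n) :=
  Equiv.swap ⟨i, Nat.lt_of_succ_lt hi⟩ ⟨i + 1, hi⟩

/-- The defining relations of the framed braid group; `u * v⁻¹` stands for `u = v`. -/
inductive FramedRel (n : ℕ) : FreeGroup (FramedGen n) → Prop
  /-- `σ_i σ_j σ_i = σ_j σ_i σ_j` for `|i - j| = 1` -/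
  | braid (i j : ℕ) (hi : i + 1 < n) (hj : j + 1 < n) (hij : j = i + 1 ∨ i = j + 1) :
      FramedRel n ((freeSigma i hi * freeSigma j hj * freeSigma i hi) *
        (freeSigma j hj * freeSigma i hi * freeSigma j hj)⁻¹)
  /-- `σ_i σ_j = σ_j σ_i` for `|i - j| > 1` -/
  | far (i j : ℕ) (hi : i + 1 < n) (hj : j + 1 < n) (hij : i + 1 < j ∨ j + 1 < i) :
      FramedRel n ((freeSigma i hi * freeSigma j hj) * (freeSigma j hj * freeSigma i hi)⁻¹)
  /-- `t_i t_j = t_j t_i` -/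
  | framing (i j : Fin n) : FramedRel n ((freeT i * freeT j) * (freeT j * freeT i)⁻¹)
  /-- `t_j σ_i = σ_i t_{s_i(j)}` -/
  | mixed (i : ℕ) (hi : i + 1 < n) (j : Fin n) :
      FramedRel n ((freeT j * freeSigma i hi) * (freeSigma i hi * freeT (strandSwap i hi j))⁻¹)

/-- The framed braid group `𝓕_n`. -/
abbrev FramedBraidGroup (n : ℕ) : Type := PresentedGroup {r | FramedRel n r}

/-- The modular framed braid group `𝓕_{d,n}`: the framings are taken modulo `d`. -/
abbrev ModularFramedBraidGroup (d n : ℕ) : Type :=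
  PresentedGroup ({r | FramedRel n r} ∪ {r | ∃ j : Fin n, r = freeT j ^ d})

/-- Renumbering of the strands: every strand number is increased by `r`. -/
def shiftGen {n m : ℕ} (r : ℕ) (h : r + n ≤ m) : FramedGen n → FramedGen m
  | .sigma i hi => .sigma (r + i) (by omega)
  | .t j => .t ⟨r + j, by omega⟩

theorem shiftGen_rel {n m : ℕ} (r : ℕ) (h : r + n ≤ m) {x : FreeGroup (FramedGen n)}
    (hx : FramedRel n x) : FramedRel m (FreeGroup.map (shiftGen r h) x) := by
  cases hx with
  | braid i j hi hj hij =>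
    simpa [freeSigma, shiftGen] using
      FramedRel.braid (n := m) (r + i) (r + j) (by omega) (by omega) (by omega)
  | far i j hi hj hij =>
    simpa [freeSigma, shiftGen] using
      FramedRel.far (n := m) (r + i) (r + j) (by omega) (by omega) (by omega)
  | framing i j =>
    simpa [freeT, shiftGen] using
      FramedRel.framing (n := m) ⟨r + i, by omega⟩ ⟨r + j, by omega⟩
  | mixed i hi j =>
    have key := FramedRel.mixed (n := m) (r + i) (by omega) ⟨r + j, by omega⟩
    have hs : strandSwap (n := m) (r + i) (by omega) ⟨r + j, by omega⟩ =
        ⟨r + (strandSwap i hi j : Fin n), by omega⟩ := by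
      obtain ⟨j, hj⟩ := j
      simp only [strandSwap, Equiv.swap_apply_def, Fin.mk.injEq, Nat.add_assoc,
        Nat.add_left_cancel_iff]
      split_ifs <;> rfl
    rw [hs] at key
    simpa [freeT, freeSigma, shiftGen] using key

/-- The homomorphism `𝓕_n → 𝓕_m`, `σ_i ↦ σ_{r+i}`, `t_j ↦ t_{r+j}`, where `r + n ≤ m`. -/
def FramedBraidGroup.shift {n m : ℕ} (r : ℕ) (h : r + n ≤ m) :
    FramedBraidGroup n →* FramedBraidGroup m :=
  PresentedGroup.toGroup (f := fun g => PresentedGroup.of (shiftGen r h g)) (by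
    intro x hx
    have := PresentedGroup.one_of_mem (rels := {r | FramedRel m r}) (shiftGen_rel r h hx)
    rw [← this, ← MonoidHom.comp_apply]
    refine DFunLike.congr_fun (FreeGroup.ext_hom _ _ fun g => ?_) x
    simp [PresentedGroup.of])

/-- The homomorphism `𝓕_{d,n} → 𝓕_{d,m}`, `σ_i ↦ σ_{r+i}`, `t_j ↦ t_{r+j}`, where `r + n ≤ m`. -/
def ModularFramedBraidGroup.shift (d : ℕ) {n m : ℕ} (r : ℕ) (h : r + n ≤ m) :
    ModularFramedBraidGroup d n →* ModularFramedBraidGroup d m :=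
  PresentedGroup.toGroup (f := fun g => PresentedGroup.of (shiftGen r h g)) (by
    intro x hx
    have hx' : FreeGroup.map (shiftGen r h) x ∈
        ({r | FramedRel m r} ∪ {r | ∃ j : Fin m, r = freeT j ^ d} :
          Set (FreeGroup (FramedGen m))) := by
      rcases hx with hx | ⟨j, rfl⟩
      · exact Or.inl (shiftGen_rel r h hx)
      · exact Or.inr ⟨⟨r + j, by omega⟩, by simp [freeT, shiftGen]⟩
    have := PresentedGroup.one_of_mem hx'
    rw [← this, ← MonoidHom.comp_apply]
    refine DFunLike.congr_fun (FreeGroup.ext_hom _ _ fun g => ?_) x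
    simp [PresentedGroup.of])

/-- The connected sum `α # β = α^{[0]} β^{[n-1]}` of framed braids on `n` and `m` strands
(here `n` and `m` are written as `n + 1` and `m + 1`), a framed braid on `n + m - 1` strands. -/
def connectedSum {n m : ℕ} (α : FramedBraidGroup (n + 1)) (β : FramedBraidGroup (m + 1)) :
    FramedBraidGroup (n + m + 1) :=
  FramedBraidGroup.shift 0 (by omega) α * FramedBraidGroup.shift n (by omega) β

/-- The natural epimorphism `𝓕_n → 𝓕_{d,n}`. -/
def toModular (d n : ℕ) : FramedBraidGroup n →* ModularFramedBraidGroup d n :=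
  PresentedGroup.toGroup (f := fun g => PresentedGroup.of g) (by
    intro x hx
    have := PresentedGroup.one_of_mem
      (rels := {r | FramedRel n r} ∪ {r | ∃ j : Fin n, r = freeT j ^ d}) (Or.inl hx)
    rw [← this]
    refine DFunLike.congr_fun (FreeGroup.ext_hom _ _ fun g => ?_) x
    simp [PresentedGroup.of])

/-! ### Yokonuma--Hecke algebras -/

/-- The braiding generator `σ_i` of `ℂ𝓕_{d,n}`. -/
def algSigma (d : ℕ) {n : ℕ} (i : ℕ) (hi : i + 1 < n) :
    MonoidAlgebra ℂ (ModularFramedBraidGroup d n) :=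
  MonoidAlgebra.of ℂ _ (PresentedGroup.of (.sigma i hi))

/-- The framing generator `t_j` as an element of `𝓕_{d,n}`. -/
def modT (d : ℕ) {n : ℕ} (j : Fin n) : ModularFramedBraidGroup d n :=
  PresentedGroup.of (.t j)

/-- The element `e_i = (1/d) ∑_{1 ≤ s ≤ d} t_i^s t_{i+1}^{-s}` of `ℂ𝓕_{d,n}`. -/
def algE (d : ℕ) {n : ℕ} (i : ℕ) (hi : i + 1 < n) :
    MonoidAlgebra ℂ (ModularFramedBraidGroup d n) :=
  (1 / (d : ℂ)) • ∑ s ∈ Finset.Icc 1 d,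
    MonoidAlgebra.of ℂ _
      (modT d ⟨i, Nat.lt_of_succ_lt hi⟩ ^ s * (modT d ⟨i + 1, hi⟩ ^ s)⁻¹)

/-- The quadratic relations `σ_i² = 1 + (q - q⁻¹) e_i σ_i`. -/
inductive QuadraticRel (d n : ℕ) (q : ℂ) :
    MonoidAlgebra ℂ (ModularFramedBraidGroup d n) →
      MonoidAlgebra ℂ (ModularFramedBraidGroup d n) → Prop
  | quad (i : ℕ) (hi : i + 1 < n) :
      QuadraticRel d n q (algSigma d i hi ^ 2) (1 + (q - q⁻¹) • (algE d i hi * algSigma d i hi))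

/-- The Yokonuma--Hecke algebra `Y_{d,n}(q)`: the quotient of `ℂ𝓕_{d,n}` by the two-sided ideal
generated by the quadratic relations. -/
abbrev YHAlgebra (d n : ℕ) (q : ℂ) : Type := RingQuot (QuadraticRel d n q)

/-- The quotient map `ℂ𝓕_{d,n} → Y_{d,n}(q)`. -/
def toYH (d n : ℕ) (q : ℂ) :
    MonoidAlgebra ℂ (ModularFramedBraidGroup d n) →ₐ[ℂ] YHAlgebra d n q :=
  RingQuot.mkAlgHom ℂ (QuadraticRel d n q)

/-- The image in `Y_{d,n}(q)` of a framed braid, under the natural epimorphism. -/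
def braidToYH (d : ℕ) {n : ℕ} (q : ℂ) (α : FramedBraidGroup n) : YHAlgebra d n q :=
  toYH d n q (MonoidAlgebra.of ℂ _ (toModular d n α))

/-- The generator `g_i` of `Y_{d,n}(q)`. -/
def genG (d : ℕ) {n : ℕ} (q : ℂ) (i : ℕ) (hi : i + 1 < n) : YHAlgebra d n q :=
  toYH d n q (algSigma d i hi)

/-- The generator `t_j` of `Y_{d,n}(q)`. -/
def genT (d : ℕ) {n : ℕ} (q : ℂ) (j : Fin n) : YHAlgebra d n q :=
  toYH d n q (MonoidAlgebra.of ℂ _ (modT d j))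

theorem mapDomain_shift_algSigma (d : ℕ) {n m : ℕ} (r : ℕ) (h : r + n ≤ m) (i : ℕ)
    (hi : i + 1 < n) :
    MonoidAlgebra.mapDomainAlgHom ℂ ℂ (ModularFramedBraidGroup.shift d r h) (algSigma d i hi)
      = algSigma d (r + i) (by omega) := by
  simp [algSigma, ModularFramedBraidGroup.shift, shiftGen]

theorem mapDomain_shift_algE (d : ℕ) {n m : ℕ} (r : ℕ) (h : r + n ≤ m) (i : ℕ)
    (hi : i + 1 < n) :
    MonoidAlgebra.mapDomainAlgHom ℂ ℂ (ModularFramedBraidGroup.shift d r h) (algE d i hi)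
      = algE d (r + i) (by omega) := by
  simp [algE, modT, ModularFramedBraidGroup.shift, shiftGen, add_assoc]

/-- The natural inclusion `Y_{d,n}(q) → Y_{d,n+1}(q)`, `g_i ↦ g_i`, `t_j ↦ t_j`. -/
def incl (d n : ℕ) (q : ℂ) : YHAlgebra d n q →ₐ[ℂ] YHAlgebra d (n + 1) q :=
  RingQuot.liftAlgHom ℂ ⟨(toYH d (n + 1) q).comp
    (MonoidAlgebra.mapDomainAlgHom ℂ ℂ (ModularFramedBraidGroup.shift d 0 (by omega))), by
      rintro _ _ ⟨i, hi⟩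
      simp only [AlgHom.comp_apply, map_pow, map_add, map_one, map_smul, map_mul,
        mapDomain_shift_algSigma, mapDomain_shift_algE]
      have := RingQuot.mkAlgHom_rel ℂ
        (QuadraticRel.quad (d := d) (n := n + 1) (q := q) (0 + i) (by omega))
      simpa only [toYH, map_pow, map_add, map_one, map_smul, map_mul] using this⟩

/-! ### The traces -/

/-- `x` is a solution of the `E`-system: with indices modulo `d` and `x₀ = 1`,
`E^{(m)} = x_m E^{(0)}` for `1 ≤ m ≤ d - 1`, where
`E^{(m)} = (1/d) ∑_{s=0}^{d-1} x_{m+s} x_{d-s}`. -/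
def IsESystemSolution (d : ℕ) [NeZero d] (x : ZMod d → ℂ) : Prop :=
  x 0 = 1 ∧ ∀ m : ℕ, 1 ≤ m → m ≤ d - 1 →
    (1 / (d : ℂ)) * ∑ s ∈ Finset.range d, x ((m : ZMod d) + s) * x ((d : ZMod d) - s) =
      x m * ((1 / (d : ℂ)) * ∑ s ∈ Finset.range d, x s * x ((d : ZMod d) - s))

/-- The rules of the Markov trace on `⋃ₙ Y_{d,n}(q)` with values in `ℂ[z]` and parameters
`x₁, …, x_{d-1}`. A linear map on the union is a family of linear maps that is compatible with
the inclusions. -/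
structure IsMarkovTrace (d : ℕ) (q : ℂ) (x : ZMod d → ℂ)
    (tr : ∀ n : ℕ, YHAlgebra d n q →ₗ[ℂ] Polynomial ℂ) : Prop where
  compat : ∀ (n : ℕ) (a : YHAlgebra d n q), tr (n + 1) (incl d n q a) = tr n a
  comm : ∀ (n : ℕ) (a b : YHAlgebra d n q), tr n (a * b) = tr n (b * a)
  one : ∀ n : ℕ, tr n 1 = 1
  markov : ∀ (n : ℕ) (a : YHAlgebra d (n + 1) q),
    tr (n + 2) (incl d (n + 1) q a * genG d q n (by omega)) = Polynomial.X * tr (n + 1) a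
  framing : ∀ (n : ℕ) (a : YHAlgebra d n q) (s : ℕ), 1 ≤ s → s ≤ d - 1 →
    tr (n + 1) (incl d n q a * genT d q (Fin.last n) ^ s) = Polynomial.C (x s) * tr n a

/-! ### Existence of the Markov trace

What follows proves that a family satisfying the rules exists. All the algebras act on
one module of functions on framed permutations of `ℕ`, as in the regular representation; the trace
is the coefficient of the identity of a product with Jucys--Murphy type operators. -/

/-- Framed permutations of `ℕ`. -/
abbrev Conf (d : ℕ) : Type := (ℕ → ZMod d) × Equiv.Perm ℕ

section Model

variable {d : ℕ} [NeZero d] {A : Type} [CommRing A]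

abbrev Mod (d : ℕ) (A : Type) : Type := Conf d → A

def opS (π : Equiv.Perm ℕ) : Module.End A (Mod d A) where
  toFun f := fun p => f (p.1 ∘ π, p.2 * π)
  map_add' _ _ := rfl
  map_smul' _ _ := rfl

def opT (j : ℕ) (s : ZMod d) : Module.End A (Mod d A) where
  toFun f := fun p => f (p.1 + Pi.single j s, p.2)
  map_add' _ _ := rfl
  map_smul' _ _ := rfl

def opD (i j : ℕ) : Module.End A (Mod d A) where
  toFun f := fun p => if p.2 j < p.2 i then f p else 0
  map_add' f g := by ext p; simp only [Pi.add_apply]; split_ifs <;> simp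
  map_smul' a f := by ext p; simp

def opE (κ : A) (i j : ℕ) : Module.End A (Mod d A) :=
  κ • ∑ s : ZMod d, opT i s * opT j (-s)

def opU (κ : A) (i j : ℕ) : Module.End A (Mod d A) := opE κ i j * opD i j

def opG (c κ : A) (i : ℕ) : Module.End A (Mod d A) :=
  opS (Equiv.swap i (i + 1)) + c • opU κ i (i + 1)

theorem opS_mul (π ρ : Equiv.Perm ℕ) : (opS π * opS ρ : Module.End A (Mod d A)) = opS (π * ρ) := rfl

theorem opS_one : (opS 1 : Module.End A (Mod d A)) = 1 := rfl

theorem opT_mul (j : ℕ) (s r : ZMod d) :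
    (opT j s * opT j r : Module.End A (Mod d A)) = opT j (s + r) := by
  ext f p
  change f (p.1 + Pi.single j s + Pi.single j r, p.2) = f (p.1 + Pi.single j (s + r), p.2)
  rw [Pi.single_add, add_assoc]

theorem opT_zero (j : ℕ) : (opT j (0 : ZMod d) : Module.End A (Mod d A)) = 1 := by
  ext f p
  change f (p.1 + Pi.single j 0, p.2) = f p
  simp

theorem opT_comm (i j : ℕ) (s r : ZMod d) :
    (opT i s * opT j r : Module.End A (Mod d A)) = opT j r * opT i s := by
  ext f p
  change f (p.1 + Pi.single i s + Pi.single j r, p.2) = f (p.1 + Pi.single j r + Pi.single i s, p.2)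
  rw [add_right_comm]

theorem opT_pow (j : ℕ) (s : ZMod d) (k : ℕ) :
    (opT j s ^ k : Module.End A (Mod d A)) = opT j ((k : ZMod d) * s) := by
  induction k with
  | zero => simp [opT_zero]
  | succ k ih => rw [pow_succ, ih, opT_mul]; congr 1; push_cast; ring

theorem opS_opT (π : Equiv.Perm ℕ) (j : ℕ) (s : ZMod d) :
    (opS π * opT j s : Module.End A (Mod d A)) = opT (π j) s * opS π := by
  ext f p
  change f (p.1 ∘ π + Pi.single j s, p.2 * π) = f ((p.1 + Pi.single (π j) s) ∘ π, p.2 * π)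
  congr 2
  ext i
  by_cases h : i = j
  · subst h; simp
  · simp [h]

theorem opS_opD (π : Equiv.Perm ℕ) (i j : ℕ) :
    (opS π * opD i j : Module.End A (Mod d A)) = opD (π i) (π j) * opS π := rfl

theorem opT_opD (k : ℕ) (s : ZMod d) (i j : ℕ) :
    (opT k s * opD i j : Module.End A (Mod d A)) = opD i j * opT k s := rfl

theorem opD_comm (i j k l : ℕ) :
    (opD i j * opD k l : Module.End A (Mod d A)) = opD k l * opD i j := by
  ext f p
  simp only [Module.End.mul_apply, opD, LinearMap.coe_mk, AddHom.coe_mk]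
  split_ifs <;> rfl

variable (c κ : A)

theorem opT_opE (k : ℕ) (s : ZMod d) (i j : ℕ) :
    (opT k s * opE κ i j : Module.End A (Mod d A)) = opE κ i j * opT k s := by
  simp only [opE, mul_smul_comm, smul_mul_assoc, Finset.mul_sum, Finset.sum_mul]
  congr 1
  refine Finset.sum_congr rfl fun r _ => ?_
  rw [← mul_assoc, opT_comm k, mul_assoc, opT_comm k, mul_assoc]

theorem opE_comm (i j k l : ℕ) :
    (opE κ i j * opE κ k l : Module.End A (Mod d A)) = opE κ k l * opE κ i j := by
  conv_lhs => rw [opE.eq_1 κ i j]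
  conv_rhs => rw [opE.eq_1 κ i j]
  simp only [mul_smul_comm, smul_mul_assoc, Finset.mul_sum, Finset.sum_mul]
  congr 1
  refine Finset.sum_congr rfl fun r _ => ?_
  rw [mul_assoc, opT_opE, ← mul_assoc, opT_opE, mul_assoc]

theorem opE_opD (i j k l : ℕ) :
    (opE κ i j * opD k l : Module.End A (Mod d A)) = opD k l * opE κ i j := by
  simp only [opE, mul_smul_comm, smul_mul_assoc, Finset.mul_sum, Finset.sum_mul]
  rfl

theorem opS_opE (π : Equiv.Perm ℕ) (i j : ℕ) :
    (opS π * opE κ i j : Module.End A (Mod d A)) = opE κ (π i) (π j) * opS π := by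
  simp only [opE, mul_smul_comm, smul_mul_assoc, Finset.mul_sum, Finset.sum_mul]
  congr 1
  refine Finset.sum_congr rfl fun r _ => ?_
  rw [← mul_assoc, opS_opT, mul_assoc, opS_opT, mul_assoc]

theorem opS_opU (π : Equiv.Perm ℕ) (i j : ℕ) :
    (opS π * opU κ i j : Module.End A (Mod d A)) = opU κ (π i) (π j) * opS π := by
  rw [opU, opU, ← mul_assoc, opS_opE, mul_assoc, opS_opD, mul_assoc]

/-- `E` identifies the two framings it averages over. -/
theorem opE_opT (i j : ℕ) (s : ZMod d) :
    (opE κ i j * opT i s : Module.End A (Mod d A)) = opE κ i j * opT j s := by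
  simp only [opE, smul_mul_assoc, Finset.sum_mul]
  congr 1
  refine Fintype.sum_equiv (Equiv.addRight s) _ _ fun r => ?_
  rw [mul_assoc, opT_comm j, ← mul_assoc, opT_mul, mul_assoc, opT_mul]
  simp

theorem opE_symm (i j : ℕ) : (opE κ i j : Module.End A (Mod d A)) = opE κ j i := by
  rw [opE, opE]
  congr 1
  refine Fintype.sum_equiv (Equiv.neg _) _ _ fun r => ?_
  rw [opT_comm]; simp

theorem opE_mul_left (a b e : ℕ) :
    (opE κ a b * opE κ b e : Module.End A (Mod d A)) = opE κ a b * opE κ a e := by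
  rw [opE.eq_1 κ b, opE.eq_1 κ a e]
  simp only [mul_smul_comm, Finset.mul_sum]
  congr 1
  refine Finset.sum_congr rfl fun r _ => ?_
  rw [← mul_assoc, ← mul_assoc, opE_opT]

theorem opE_mul_right (a b e : ℕ) :
    (opE κ a b * opE κ b e : Module.End A (Mod d A)) = opE κ a e * opE κ b e := by
  rw [opE_comm, opE_symm κ b e, opE_symm κ a b, opE_mul_left, opE_comm, opE_symm κ e a]

variable {κ}

theorem opE_idem (hκ : κ * d = 1) (i j : ℕ) :
    (opE κ i j * opE κ i j : Module.End A (Mod d A)) = opE κ i j := by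
  have key : ∀ r : ZMod d, (opE κ i j * (opT i r * opT j (-r)) : Module.End A (Mod d A))
      = opE κ i j := fun r => by
    rw [← mul_assoc, opE_opT, mul_assoc, opT_mul, add_neg_cancel, opT_zero, mul_one]
  conv_lhs => rw [opE.eq_1 κ i j]; simp only [mul_smul_comm, Finset.mul_sum]
  rw [← opE.eq_1 κ i j]
  simp only [key, Finset.sum_const, Finset.card_univ, ZMod.card]
  rw [← Nat.cast_smul_eq_nsmul A, smul_smul, hκ, one_smul]

theorem opU_comm (i j k l : ℕ) :
    (opU κ i j * opU κ k l : Module.End A (Mod d A)) = opU κ k l * opU κ i j := by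
  simp only [opU]
  rw [mul_assoc, ← mul_assoc (opD i j), ← opE_opD, mul_assoc, ← mul_assoc, opE_comm, opD_comm i j,
    mul_assoc, ← mul_assoc (opE κ i j), opE_opD, mul_assoc, ← mul_assoc]

theorem opU_mul (i j k l : ℕ) :
    (opU κ i j * opU κ k l : Module.End A (Mod d A))
      = (opE κ i j * opE κ k l) * (opD i j * opD k l) := by
  simp only [opU]
  rw [mul_assoc, ← mul_assoc (opD i j), ← opE_opD, mul_assoc, ← mul_assoc]

theorem opU_idem (hκ : κ * d = 1) (i j : ℕ) :
    (opU κ i j * opU κ i j : Module.End A (Mod d A)) = opU κ i j := by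
  rw [opU_mul, opE_idem hκ, opU]
  congr 1
  ext f p
  simp only [Module.End.mul_apply, opD, LinearMap.coe_mk, AddHom.coe_mk]
  split_ifs <;> rfl

theorem opD_rel (a b e : ℕ) (hab : a ≠ b) :
    (opD a b * opD b e + opD a e * opD b a : Module.End A (Mod d A)) = opD a e * opD b e := by
  ext f p
  simp only [Module.End.mul_apply, opD, LinearMap.coe_mk, AddHom.coe_mk, LinearMap.add_apply,
    Pi.add_apply]
  have h : p.2 a ≠ p.2 b := fun h => hab (p.2.injective h)
  split_ifs <;> first | omega | simp

theorem opD_rel' (a b e : ℕ) (hbe : b ≠ e) :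
    (opD a b * opD b e + opD a e * opD e b : Module.End A (Mod d A)) = opD a b * opD a e := by
  ext f p
  simp only [Module.End.mul_apply, opD, LinearMap.coe_mk, AddHom.coe_mk, LinearMap.add_apply,
    Pi.add_apply]
  have h : p.2 b ≠ p.2 e := fun h => hbe (p.2.injective h)
  split_ifs <;> first | omega | simp

theorem opU_rel (a b e : ℕ) (hab : a ≠ b) :
    (opU κ a b * opU κ b e + opU κ a e * opU κ b a : Module.End A (Mod d A))
      = opU κ a e * opU κ b e := by
  rw [opU_mul, opU_mul, opU_mul, ← opD_rel a b e hab, mul_add, opE_mul_right,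
    ← opE_mul_right κ a b e, opE_mul_left, opE_symm κ b a, opE_comm κ a e a b]

theorem opU_rel' (a b e : ℕ) (hbe : b ≠ e) :
    (opU κ a b * opU κ b e + opU κ a e * opU κ e b : Module.End A (Mod d A))
      = opU κ a b * opU κ a e := by
  rw [opU_mul, opU_mul, opU_mul, ← opD_rel' a b e hbe, mul_add, opE_mul_left,
    opE_mul_left, opE_comm κ a e]

theorem opU_symm_add (a b : ℕ) (h : a ≠ b) :
    (opU κ a b + opU κ b a : Module.End A (Mod d A)) = opE κ a b := by
  rw [opU, opU, opE_symm κ b a, ← mul_add]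
  conv_rhs => rw [← mul_one (opE κ a b)]
  congr 1
  ext f p
  have h : p.2 a ≠ p.2 b := fun h' => h (p.2.injective h')
  simp only [opD, LinearMap.coe_mk, AddHom.coe_mk, LinearMap.add_apply,
    Pi.add_apply, Module.End.one_apply]
  split_ifs <;> first | omega | simp

variable (κ)

theorem opG_opT (i j : ℕ) (s : ZMod d) :
    (opG c κ i * opT j s : Module.End A (Mod d A))
      = opT (Equiv.swap i (i + 1) j) s * opG c κ i := by
  have key : (opU κ i (i + 1) * opT j s : Module.End A (Mod d A))
      = opT (Equiv.swap i (i + 1) j) s * opU κ i (i + 1) := by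
    have h1 : (opU κ i (i + 1) * opT j s : Module.End A (Mod d A))
      = opE κ i (i + 1) * opT j s * opD i (i + 1) := by
      rw [opU, mul_assoc, ← opT_opD, mul_assoc]
    have h2 : (opT (Equiv.swap i (i + 1) j) s * opU κ i (i + 1) : Module.End A (Mod d A))
      = opE κ i (i + 1) * opT (Equiv.swap i (i + 1) j) s * opD i (i + 1) := by
      rw [opU, ← mul_assoc, opT_opE]
    rw [h1, h2]
    congr 1
    by_cases hi : j = i
    · subst hi; rw [Equiv.swap_apply_left, opE_opT]
    by_cases hi' : j = i + 1
    · subst hi'; rw [Equiv.swap_apply_right, opE_opT]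
    rw [Equiv.swap_apply_of_ne_of_ne hi hi']
  rw [opG, add_mul, mul_add, opS_opT, smul_mul_assoc, mul_smul_comm, key]

theorem opE_opG (i j : ℕ) (k : ℕ) :
    (opG c κ k * opE κ i j : Module.End A (Mod d A))
      = opE κ (Equiv.swap k (k + 1) i) (Equiv.swap k (k + 1) j) * opG c κ k := by
  simp only [opE, mul_smul_comm, smul_mul_assoc, Finset.mul_sum, Finset.sum_mul]
  congr 1
  refine Finset.sum_congr rfl fun r _ => ?_
  rw [← mul_assoc, opG_opT, mul_assoc, opG_opT, mul_assoc]

theorem opG_far (i j : ℕ) (h : i + 1 < j) :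
    (opG c κ i * opG c κ j : Module.End A (Mod d A)) = opG c κ j * opG c κ i := by
  have h1 : (opS (Equiv.swap i (i + 1)) * opU κ j (j + 1) : Module.End A (Mod d A))
      = opU κ j (j + 1) * opS (Equiv.swap i (i + 1)) := by
    rw [opS_opU, Equiv.swap_apply_of_ne_of_ne, Equiv.swap_apply_of_ne_of_ne] <;> omega
  have h2 : (opS (Equiv.swap j (j + 1)) * opU κ i (i + 1) : Module.End A (Mod d A))
      = opU κ i (i + 1) * opS (Equiv.swap j (j + 1)) := by
    rw [opS_opU, Equiv.swap_apply_of_ne_of_ne, Equiv.swap_apply_of_ne_of_ne] <;> omega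
  have h3 : (opS (Equiv.swap i (i + 1)) * opS (Equiv.swap j (j + 1)) : Module.End A (Mod d A))
      = opS (Equiv.swap j (j + 1)) * opS (Equiv.swap i (i + 1)) := by
    rw [opS_mul, opS_mul]
    congr 1
    refine (Equiv.Perm.Disjoint.commute ?_).eq
    intro x
    by_cases hx : x = i ∨ x = i + 1
    · right; apply Equiv.swap_apply_of_ne_of_ne <;> omega
    · left; apply Equiv.swap_apply_of_ne_of_ne <;> omega
  simp only [opG, add_mul, mul_add, smul_mul_assoc, mul_smul_comm]
  rw [h1, h2, h3, opU_comm i]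
  module

variable {κ}

theorem opG_sq (hκ : κ * d = 1) (i : ℕ) :
    (opG c κ i * opG c κ i : Module.End A (Mod d A))
      = 1 + c • (opE κ i (i + 1) * opG c κ i) := by
  have h1 : (opS (Equiv.swap i (i + 1)) * opU κ i (i + 1) : Module.End A (Mod d A))
      = opU κ (i + 1) i * opS (Equiv.swap i (i + 1)) := by
    rw [opS_opU, Equiv.swap_apply_left, Equiv.swap_apply_right]
  have h3 : (opS (Equiv.swap i (i + 1)) * opS (Equiv.swap i (i + 1)) : Module.End A (Mod d A))
      = 1 := by
    rw [opS_mul, Equiv.swap_mul_self, opS_one]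
  have h4 : (opE κ i (i + 1) * opU κ i (i + 1) : Module.End A (Mod d A)) = opU κ i (i + 1) := by
    rw [opU, ← mul_assoc, opE_idem hκ]
  simp only [opG, add_mul, mul_add, smul_mul_assoc, mul_smul_comm, h4]
  rw [h1, h3, opU_idem hκ, ← opU_symm_add i (i + 1) (by omega), add_mul]
  module

theorem opG_braid (hκ : κ * d = 1) (i : ℕ) :
    (opG c κ i * opG c κ (i + 1) * opG c κ i : Module.End A (Mod d A))
      = opG c κ (i + 1) * opG c κ i * opG c κ (i + 1) := by
  set s := Equiv.swap i (i + 1) with hs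
  set r := Equiv.swap (i + 1) (i + 1 + 1) with hr
  have s0 : s i = i + 1 := Equiv.swap_apply_left _ _
  have s1 : s (i + 1) = i := Equiv.swap_apply_right _ _
  have s2 : s (i + 1 + 1) = i + 1 + 1 := Equiv.swap_apply_of_ne_of_ne (by omega) (by omega)
  have r0 : r i = i := Equiv.swap_apply_of_ne_of_ne (by omega) (by omega)
  have r1 : r (i + 1) = i + 1 + 1 := Equiv.swap_apply_left _ _
  have r2 : r (i + 1 + 1) = i + 1 := Equiv.swap_apply_right _ _
  have ss : s * s = 1 := Equiv.swap_mul_self _ _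
  have rr : r * r = 1 := Equiv.swap_mul_self _ _
  have br : s * r * s = r * s * r := by
    ext x
    simp only [Equiv.Perm.mul_apply]
    by_cases h0 : x = i
    · subst h0; simp only [s0, s1, s2, r0, r1, r2]
    by_cases h1 : x = i + 1
    · subst h1; simp only [s0, s1, s2, r0, r1, r2]
    by_cases h2 : x = i + 1 + 1
    · subst h2; simp only [s0, s1, s2, r0, r1, r2]
    have hs : s x = x := Equiv.swap_apply_of_ne_of_ne h0 h1
    have hr : r x = x := Equiv.swap_apply_of_ne_of_ne h1 h2
    simp only [hs, hr]
  have H1 := opU_rel (d := d) (A := A) (κ := κ) i (i + 1) (i + 1 + 1) (by omega)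
  have H2 := opU_rel' (d := d) (A := A) (κ := κ) i (i + 1) (i + 1 + 1) (by omega)
  have key : ∀ (u v : Module.End A (Mod d A)) (π : Equiv.Perm ℕ) (a b : ℕ),
      u * opS π * opU κ a b = u * opU κ (π a) (π b) * opS π := fun u v π a b => by
    rw [mul_assoc, opS_opU, ← mul_assoc]
  simp only [opG, ← hs, ← hr]
  generalize hj : i + 1 = j at *
  generalize hk : j + 1 = k at *
  have b1 : (opS s * opS r * opS s : Module.End A (Mod d A)) = opS r * opS s * opS r := by
    simp only [opS_mul, br]
  have b2 : (opS s * opS s : Module.End A (Mod d A)) = 1 := by rw [opS_mul, ss, opS_one]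
  have b3 : (opS r * opS r : Module.End A (Mod d A)) = 1 := by rw [opS_mul, rr, opS_one]
  have m1 : (opS s * opU κ i j : Module.End A (Mod d A)) = opU κ j i * opS s := by
    rw [opS_opU, s0, s1]
  have m2 : (opS s * opU κ j k : Module.End A (Mod d A)) = opU κ i k * opS s := by
    rw [opS_opU, s1, s2]
  have m3 : (opS r * opU κ i j : Module.End A (Mod d A)) = opU κ i k * opS r := by
    rw [opS_opU, r0, r1]
  have m4 : (opS r * opU κ j k : Module.End A (Mod d A)) = opU κ k j * opS r := by
    rw [opS_opU, r1, r2]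
  have m5 : (opS s * opU κ i k : Module.End A (Mod d A)) = opU κ j k * opS s := by
    rw [opS_opU, s0, s2]
  have m6 : (opS r * opU κ i k : Module.End A (Mod d A)) = opU κ i j * opS r := by
    rw [opS_opU, r0, r2]
  have i1 := opU_idem (d := d) (A := A) hκ i j
  have i2 := opU_idem (d := d) (A := A) hκ j k
  have c1 := opU_comm (d := d) (A := A) (κ := κ) i j j k
  have c2 := opU_comm (d := d) (A := A) (κ := κ) i j i k
  have c3 := opU_comm (d := d) (A := A) (κ := κ) i k j k
  generalize (opU κ i j : Module.End A (Mod d A)) = u at *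
  generalize (opU κ j k : Module.End A (Mod d A)) = v at *
  generalize (opU κ i k : Module.End A (Mod d A)) = w at *
  generalize (opU κ j i : Module.End A (Mod d A)) = u' at *
  generalize (opU κ k j : Module.End A (Mod d A)) = v' at *
  generalize (opS s : Module.End A (Mod d A)) = S at *
  generalize (opS r : Module.End A (Mod d A)) = R at *
  have e1 : u * S * u = u * u' * S := by rw [mul_assoc, m1, mul_assoc]
  have L : (S + c • u) * (R + c • v) * (S + c • u)
      = S * R * S + c • (S * R * u) + c • (S * v * S) + c • (u * R * S)
        + (c * c) • (S * v * u) + (c * c) • (u * R * u) + (c * c) • (u * v * S)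
        + (c * c * c) • (u * v * u) := by
    simp only [add_mul, mul_add, smul_mul_assoc, mul_smul_comm, smul_smul, smul_add, mul_assoc]
    abel
  have L' : (R + c • v) * (S + c • u) * (R + c • v)
      = R * S * R + c • (R * S * v) + c • (R * u * R) + c • (v * S * R)
        + (c * c) • (R * u * v) + (c * c) • (v * S * v) + (c * c) • (v * u * R)
        + (c * c * c) • (v * u * v) := by
    simp only [add_mul, mul_add, smul_mul_assoc, mul_smul_comm, smul_smul, smul_add, mul_assoc]
    abel
  rw [L, L']
  have t1 : S * R * u = v * S * R := by rw [mul_assoc, m3, ← mul_assoc, m5, mul_assoc]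
  have t2 : R * S * v = u * R * S := by rw [mul_assoc, m2, ← mul_assoc, m6, mul_assoc]
  have t3 : S * v * S = w := by rw [m2, mul_assoc, b2, mul_one]
  have t4 : R * u * R = w := by rw [m3, mul_assoc, b3, mul_one]
  have t5 : S * v * u = w * u' * S := by rw [m2, mul_assoc, m1, mul_assoc]
  have t6 : R * u * v = w * v' * R := by rw [m3, mul_assoc, m4, mul_assoc]
  have t7 : u * R * u = u * w * R := by rw [mul_assoc, m3, mul_assoc]
  have t8 : v * S * v = w * v * S := by rw [mul_assoc, m2, c3, mul_assoc]
  have t9 : u * v * u = v * u * v := by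
    rw [c1, mul_assoc, i1, mul_assoc, c1, ← mul_assoc, i2]
  rw [b1, t1, t2, t3, t4, t5, t6, t7, t8, t9, ← H1, ← H2, c1]
  simp only [add_mul]
  module

variable (κ)

/-- Framing operators acting on the right of the regular representation. -/
def opT' (j : ℕ) (s : ZMod d) : Module.End A (Mod d A) where
  toFun f := fun p => f (p.1 + Pi.single (p.2⁻¹ j) s, p.2)
  map_add' _ _ := rfl
  map_smul' _ _ := rfl

/-- Braid operators acting on the right of the regular representation. -/
def opG' (j : ℕ) : Module.End A (Mod d A) where
  toFun f := fun p => f (p.1, Equiv.swap j (j + 1) * p.2) +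
    c * (if p.2⁻¹ (j + 1) < p.2⁻¹ j then opE κ (p.2⁻¹ j) (p.2⁻¹ (j + 1)) f p else 0)
  map_add' f g := by
    ext p; simp only [Pi.add_apply, map_add]; split_ifs <;> ring
  map_smul' a f := by
    ext p; simp only [Pi.smul_apply, map_smul, smul_eq_mul, RingHom.id_apply]; split_ifs <;> ring

theorem opG_apply (i : ℕ) (f : Mod d A) (k : ℕ → ZMod d) (a : Equiv.Perm ℕ) :
    opG c κ i f (k, a) = f (k ∘ Equiv.swap i (i + 1), a * Equiv.swap i (i + 1)) +
      c * (if a (i + 1) < a i then opE κ i (i + 1) f (k, a) else 0) := by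
  simp only [opG, opU, ← opE_opD]
  rw [opE_opD]
  rfl

theorem opG'_apply (j : ℕ) (f : Mod d A) (k : ℕ → ZMod d) (a : Equiv.Perm ℕ) :
    opG' c κ j f (k, a) = f (k, Equiv.swap j (j + 1) * a) +
    c * (if a⁻¹ (j + 1) < a⁻¹ j then opE κ (a⁻¹ j) (a⁻¹ (j + 1)) f (k, a) else 0) := rfl

theorem opE_apply (i j : ℕ) (f : Mod d A) (k : ℕ → ZMod d) (a : Equiv.Perm ℕ) :
    opE κ i j f (k, a) = κ * ∑ s : ZMod d, f (k + Pi.single i s + Pi.single j (-s), a) := by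
  simp only [opE, LinearMap.smul_apply, LinearMap.sum_apply, Pi.smul_apply, Finset.sum_apply,
    smul_eq_mul]
  rfl

theorem opT_opT' (i j : ℕ) (s r : ZMod d) :
    (opT i s * opT' j r : Module.End A (Mod d A)) = opT' j r * opT i s := by
  ext f ⟨k, a⟩
  change f (k + Pi.single i s + Pi.single (a⁻¹ j) r, a) =
    f (k + Pi.single (a⁻¹ j) r + Pi.single i s, a)
  rw [add_right_comm]

theorem opE_opT' (i j l : ℕ) (s : ZMod d) :
    (opE κ i j * opT' l s : Module.End A (Mod d A)) = opT' l s * opE κ i j := by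
  simp only [opE, mul_smul_comm, smul_mul_assoc, Finset.mul_sum, Finset.sum_mul]
  congr 1
  refine Finset.sum_congr rfl fun r _ => ?_
  rw [mul_assoc, opT_opT', ← mul_assoc, opT_opT', mul_assoc]

theorem opG_opT' (i j : ℕ) (s : ZMod d) :
    (opG c κ i * opT' j s : Module.End A (Mod d A)) = opT' j s * opG c κ i := by
  have h1 : (opS (Equiv.swap i (i + 1)) * opT' j s : Module.End A (Mod d A))
      = opT' j s * opS (Equiv.swap i (i + 1)) := by
    ext f ⟨k, a⟩
    change f (k ∘ Equiv.swap i (i + 1) + Pi.single ((a * Equiv.swap i (i + 1))⁻¹ j) s, _) =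
      f ((k + Pi.single (a⁻¹ j) s) ∘ Equiv.swap i (i + 1), _)
    congr 2
    ext l
    simp only [Pi.add_apply, Function.comp_apply, Pi.single_apply, mul_inv_rev, Equiv.swap_inv,
      Equiv.Perm.mul_apply]
    congr 2
    rw [eq_iff_iff]
    constructor
    · rintro rfl; simp
    · intro h; rw [← h]; simp
  have h2 : (opD i (i + 1) * opT' j s : Module.End A (Mod d A)) = opT' j s * opD i (i + 1) := rfl
  rw [opG, add_mul, mul_add, h1, opU, smul_mul_assoc, mul_smul_comm, mul_assoc, h2, ← mul_assoc,
    opE_opT', mul_assoc]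

theorem opT_opG' (i j : ℕ) (s : ZMod d) :
    (opT i s * opG' c κ j : Module.End A (Mod d A)) = opG' c κ j * opT i s := by
  ext f ⟨k, a⟩
  change opG' c κ j f (k + Pi.single i s, a) = opG' c κ j (opT i s f) (k, a)
  rw [opG'_apply, opG'_apply]
  have := congrArg (fun h : Module.End A (Mod d A) => h f (k, a))
    (opT_opE κ i s (a⁻¹ j) (a⁻¹ (j + 1)))
  change opE κ _ _ f (k + Pi.single i s, a) = opE κ _ _ (opT i s f) (k, a) at this
  rw [this]
  rfl

theorem opE_opG' (i i' j : ℕ) :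
    (opE κ i i' * opG' c κ j : Module.End A (Mod d A)) = opG' c κ j * opE κ i i' := by
  simp only [opE, mul_smul_comm, smul_mul_assoc, Finset.mul_sum, Finset.sum_mul]
  congr 1
  refine Finset.sum_congr rfl fun r _ => ?_
  rw [mul_assoc, opT_opG', ← mul_assoc, opT_opG', mul_assoc]

/-- Averaging over two framings absorbs their transposition. -/
theorem opE_swap (i j : ℕ) (f : Mod d A) (k : ℕ → ZMod d) (a : Equiv.Perm ℕ) (hij : i ≠ j) :
    opE κ i j f (k ∘ Equiv.swap i j, a) = opE κ i j f (k, a) := by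
  rw [opE_apply, opE_apply]
  congr 1
  refine Fintype.sum_equiv (Equiv.addRight (k j - k i)) _ _ fun s => ?_
  congr 2
  ext l
  by_cases h1 : l = i
  · subst h1; simp [hij]; ring
  by_cases h2 : l = j
  · subst h2; simp [h1]; ring
  simp [h1, h2, Equiv.swap_apply_of_ne_of_ne]

theorem opG_opG' (i j : ℕ) :
    (opG c κ i * opG' c κ j : Module.End A (Mod d A)) = opG' c κ j * opG c κ i := by
  ext f ⟨k, a⟩
  simp only [Module.End.mul_apply]
  rw [opG_apply, opG'_apply]
  have e1 : opE κ i (i + 1) (opG' c κ j f) (k, a) = opG' c κ j (opE κ i (i + 1) f) (k, a) :=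
    congrArg (fun h : Module.End A (Mod d A) => h f (k, a)) (opE_opG' c κ i (i + 1) j)
  set s := Equiv.swap i (i + 1) with hs
  set r := Equiv.swap j (j + 1) with hr
  have e2 : opE κ (a⁻¹ j) (a⁻¹ (j + 1)) (opG c κ i f) (k, a)
      = opE κ (s (a⁻¹ j)) (s (a⁻¹ (j + 1))) f (k ∘ s, a * s) +
      c * (if a (i + 1) < a i then
        opE κ i (i + 1) (opE κ (a⁻¹ j) (a⁻¹ (j + 1)) f) (k, a) else 0) := by
    have h := congrArg (fun h : Module.End A (Mod d A) => h f (k, a))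
      (opS_opE κ s (s (a⁻¹ j)) (s (a⁻¹ (j + 1))))
    simp only [Module.End.mul_apply, hs, Equiv.swap_apply_self] at h
    change opE κ (s (a⁻¹ j)) (s (a⁻¹ (j + 1))) f (k ∘ s, a * s) = _ at h
    rw [h, opG, opU]
    have h' := congrArg (fun h : Module.End A (Mod d A) => h f (k, a))
      (show opE κ (a⁻¹ j) (a⁻¹ (j + 1)) * (opE κ i (i + 1) * opD i (i + 1))
        = opD i (i + 1) * (opE κ i (i + 1) * opE κ (a⁻¹ j) (a⁻¹ (j + 1))) by
        rw [← mul_assoc, opE_comm, mul_assoc, opE_opD, ← mul_assoc, opE_opD, mul_assoc])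
    simp only [Module.End.mul_apply] at h'
    simp only [LinearMap.add_apply, map_add, LinearMap.smul_apply, map_smul, Pi.add_apply,
      Pi.smul_apply, Module.End.mul_apply, h', smul_eq_mul]
    rfl
  rw [e1, opG'_apply c κ j (opE κ i (i + 1) f),
    opG'_apply c κ j (opG c κ i f), e2, opG_apply]
  have hinv : (a * s)⁻¹ = s * a⁻¹ := by rw [mul_inv_rev, hs, Equiv.swap_inv]
  simp only [hinv, Equiv.Perm.mul_apply, ← hs, ← hr, mul_assoc]
  have hmon : ∀ x y : ℕ, x ≠ y → ¬ (x = i ∧ y = i + 1) → ¬ (x = i + 1 ∧ y = i) →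
      (s x < s y ↔ x < y) := by
    intro x y hxy h1 h2
    simp only [hs, Equiv.swap_apply_def]
    split_ifs <;> omega
  have hmon' : ∀ x y : ℕ, x ≠ y → ¬ (x = j ∧ y = j + 1) → ¬ (x = j + 1 ∧ y = j) →
      (r x < r y ↔ x < y) := by
    intro x y hxy h1 h2
    simp only [hr, Equiv.swap_apply_def]
    split_ifs <;> omega
  have hne : a⁻¹ j ≠ a⁻¹ (j + 1) := fun h => by simpa using a⁻¹.injective h
  have hne' : a i ≠ a (i + 1) := fun h => by simpa using a.injective h
  by_cases hA : a i = j ∧ a (i + 1) = j + 1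
  · obtain ⟨h1, h2⟩ := hA
    have h1' : a⁻¹ j = i := by rw [← h1]; simp
    have h2' : a⁻¹ (j + 1) = i + 1 := by rw [← h2]; simp
    have hc : a * s = r * a := by
      have := Equiv.mul_swap_eq_swap_mul a i (i + 1)
      rwa [h1, h2] at this
    have s0 : s i = i + 1 := Equiv.swap_apply_left _ _
    have s1 : s (i + 1) = i := Equiv.swap_apply_right _ _
    have r0 : r j = j + 1 := Equiv.swap_apply_left _ _
    have r1 : r (j + 1) = j := Equiv.swap_apply_right _ _
    simp only [h1, h2, h1', h2', s0, s1, r0, r1, ← hc]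
    rw [opE_symm κ (i + 1) i, opE_swap κ i (i + 1) f k _ (by omega)]
    simp
  by_cases hB : a i = j + 1 ∧ a (i + 1) = j
  · obtain ⟨h1, h2⟩ := hB
    have h1' : a⁻¹ j = i + 1 := by rw [← h2]; simp
    have h2' : a⁻¹ (j + 1) = i := by rw [← h1]; simp
    have hc : a * s = r * a := by
      have := Equiv.mul_swap_eq_swap_mul a i (i + 1)
      rwa [h1, h2, Equiv.swap_comm (j + 1)] at this
    have s0 : s i = i + 1 := Equiv.swap_apply_left _ _
    have s1 : s (i + 1) = i := Equiv.swap_apply_right _ _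
    have r0 : r j = j + 1 := Equiv.swap_apply_left _ _
    have r1 : r (j + 1) = j := Equiv.swap_apply_right _ _
    simp only [h1, h2, h1', h2', s0, s1, r0, r1, ← hc]
    rw [opE_symm κ (i + 1) i, opE_swap κ i (i + 1) f k _ (by omega)]
    simp
  have q1 : ¬ (a⁻¹ j = i ∧ a⁻¹ (j + 1) = i + 1) := by
    rintro ⟨h1, h2⟩; exact hA ⟨by rw [← h1]; simp, by rw [← h2]; simp⟩
  have q2 : ¬ (a⁻¹ j = i + 1 ∧ a⁻¹ (j + 1) = i) := by
    rintro ⟨h1, h2⟩; exact hB ⟨by rw [← h2]; simp, by rw [← h1]; simp⟩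
  simp only [hmon _ _ hne.symm (by tauto) (by tauto), hmon' _ _ hne'.symm (by tauto) (by tauto)]
  have e3 : opE κ i (i + 1) (opE κ (a⁻¹ j) (a⁻¹ (j + 1)) f) (k, a)
      = opE κ (a⁻¹ j) (a⁻¹ (j + 1)) (opE κ i (i + 1) f) (k, a) :=
    congrArg (fun h : Module.End A (Mod d A) => h f (k, a))
      (opE_comm κ i (i + 1) (a⁻¹ j) (a⁻¹ (j + 1)))
  rw [e3]
  split_ifs <;> ring

open Classical in
/-- The indicator function of the identity configuration. -/
def vac : Mod d A := fun p => if p.1 = 0 ∧ p.2 = 1 then 1 else 0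

theorem vac_apply (k : ℕ → ZMod d) (a : Equiv.Perm ℕ) [Decidable (k = 0 ∧ a = 1)] :
    (vac : Mod d A) (k, a) = if k = 0 ∧ a = 1 then 1 else 0 := by
  simp only [vac]
  split_ifs <;> rfl

theorem vac_ne (k : ℕ → ZMod d) {a : Equiv.Perm ℕ} (h : a ≠ 1) : (vac : Mod d A) (k, a) = 0 := by
  simp [vac, h]

theorem opE_vac (i j : ℕ) (k : ℕ → ZMod d) {a : Equiv.Perm ℕ} (h : a ≠ 1) :
    opE κ i j (vac : Mod d A) (k, a) = 0 := by
  rw [opE_apply]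
  simp [vac_ne _ h]

/-- The coefficient of the identity in the regular representation. -/
def tau : Module.End A (Mod d A) →ₗ[A] A where
  toFun h := h vac (0, 1)
  map_add' _ _ := rfl
  map_smul' _ _ := rfl

/-- The algebra generated by the operators on the first `n` strands. -/
def opAlg (n : ℕ) : Subalgebra A (Module.End A (Mod d A)) :=
  Algebra.adjoin A ({h | ∃ i, i + 1 < n ∧ h = opG c κ i} ∪ {h | ∃ j s, j < n ∧ h = opT j s})

theorem opG_mem {i n : ℕ} (h : i + 1 < n) : (opG c κ i : Module.End A (Mod d A)) ∈ opAlg c κ n :=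
  Algebra.subset_adjoin (Or.inl ⟨i, h, rfl⟩)

theorem opT_mem {j n : ℕ} (h : j < n) (s : ZMod d) :
    (opT j s : Module.End A (Mod d A)) ∈ opAlg c κ n :=
  Algebra.subset_adjoin (Or.inr ⟨j, s, h, rfl⟩)

theorem opE_mem {i j n : ℕ} (h : i < n) (h' : j < n) :
    (opE κ i j : Module.End A (Mod d A)) ∈ opAlg c κ n :=
  Subalgebra.smul_mem _ (Subalgebra.sum_mem _ fun s _ =>
    Subalgebra.mul_mem _ (opT_mem c κ h s) (opT_mem c κ h' (-s))) _

theorem opAlg_mono {n m : ℕ} (h : n ≤ m) :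
    (opAlg c κ n : Subalgebra A (Module.End A (Mod d A))) ≤ opAlg c κ m := by
  refine Algebra.adjoin_le ?_
  rintro _ (⟨i, hi, rfl⟩ | ⟨j, s, hj, rfl⟩)
  · exact opG_mem c κ (by omega)
  · exact opT_mem c κ (by omega) s

theorem opAlg_commute {n : ℕ} {y : Module.End A (Mod d A)}
    (hG : ∀ i, i + 1 < n → Commute (opG c κ i) y) (hT : ∀ j s, j < n → Commute (opT j s) y)
    {h : Module.End A (Mod d A)} (hh : h ∈ opAlg c κ n) : Commute h y := by
  induction hh using Algebra.adjoin_induction with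
  | mem x hx =>
    rcases hx with ⟨i, hi, rfl⟩ | ⟨j, s, hj, rfl⟩
    · exact hG i hi
    · exact hT j s hj
  | algebraMap r => exact Algebra.commutes r y
  | add x y _ _ h1 h2 => exact h1.add_left h2
  | mul x y _ _ h1 h2 => exact h1.mul_left h2

theorem tau_opG {n : ℕ} {h : Module.End A (Mod d A)} (hh : h ∈ opAlg c κ n) (i : ℕ) :
    tau (h * opG c κ i) = tau (opG c κ i * h) := by
  have h1 : opG c κ i (vac : Mod d A) = opG' c κ i vac := by
    ext ⟨k, a⟩
    rw [opG_apply, opG'_apply]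
    congr 1
    · classical
      simp only [vac_apply]
      congr 1
      rw [eq_iff_iff]
      refine and_congr ?_ ?_
      · constructor
        · intro h
          ext l
          simpa using congrFun h (Equiv.swap i (i + 1) l)
        · rintro rfl; rfl
      · rw [mul_eq_one_iff_eq_inv, mul_eq_one_iff_inv_eq, Equiv.swap_inv, eq_comm]
    · by_cases ha : a = 1
      · subst ha; simp
      · simp [opE_vac _ _ _ _ ha]
  have h2 : ∀ f : Mod d A, opG c κ i f (0, 1) = opG' c κ i f (0, 1) := by
    intro f
    rw [opG_apply, opG'_apply]
    simp
  have hc : Commute h (opG' c κ i) :=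
    opAlg_commute c κ (fun l _ => opG_opG' c κ l i) (fun j s _ => opT_opG' c κ j i s) hh
  change h (opG c κ i vac) (0, 1) = opG c κ i (h vac) (0, 1)
  rw [h1, h2]
  exact congrArg (fun u : Module.End A (Mod d A) => u vac (0, 1)) hc.eq

theorem tau_opT {n : ℕ} {h : Module.End A (Mod d A)} (hh : h ∈ opAlg c κ n) (j : ℕ) (s : ZMod d) :
    tau (h * opT j s) = tau (opT j s * h) := by
  have h1 : opT j s (vac : Mod d A) = opT' j s vac := by
    ext ⟨k, a⟩
    change (vac : Mod d A) (k + Pi.single j s, a) =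
      (vac : Mod d A) (k + Pi.single (a⁻¹ j) s, a)
    by_cases ha : a = 1
    · subst ha; simp
    · rw [vac_ne _ ha, vac_ne _ ha]
  have hc : Commute h (opT' j s) :=
    opAlg_commute c κ (fun l _ => opG_opT' c κ l j s) (fun l r _ => opT_opT' l j r s) hh
  change h (opT j s vac) (0, 1) = opT j s (h vac) (0, 1)
  rw [h1]
  exact congrArg (fun u : Module.End A (Mod d A) => u vac (0, 1)) hc.eq

theorem tau_comm {n : ℕ} {h y : Module.End A (Mod d A)} (hh : h ∈ opAlg c κ n)
    (hy : y ∈ opAlg c κ n) : tau (h * y) = tau (y * h) := by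
  induction hy using Algebra.adjoin_induction generalizing h with
  | mem x hx =>
    rcases hx with ⟨i, hi, rfl⟩ | ⟨j, s, hj, rfl⟩
    · exact tau_opG c κ hh i
    · exact tau_opT c κ hh j s
  | algebraMap r => rw [Algebra.commutes]
  | add x y _ _ h1 h2 => rw [mul_add, add_mul, map_add, map_add, h1 hh, h2 hh]
  | mul x y hx hy h1 h2 =>
    rw [← mul_assoc, h2 (Subalgebra.mul_mem _ hh hx), ← mul_assoc,
      h1 (Subalgebra.mul_mem _ hy hh), mul_assoc]

/-- Elements on `n` strands preserve the functions vanishing on configurations on `n` strands. -/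
theorem opAlg_vanish {n : ℕ} {h : Module.End A (Mod d A)} (hh : h ∈ opAlg c κ n) (f : Mod d A)
    (hf : ∀ k a, (∀ j, n ≤ j → k j = 0) → (∀ j, n ≤ j → a j = j) → f (k, a) = 0) :
    ∀ k a, (∀ j, n ≤ j → k j = 0) → (∀ j, n ≤ j → a j = j) → h f (k, a) = 0 := by
  induction hh using Algebra.adjoin_induction generalizing f with
  | mem x hx =>
    intro k a hk ha
    rcases hx with ⟨i, hi, rfl⟩ | ⟨l, s, hl, rfl⟩
    · rw [opG_apply, opE_apply, hf, Finset.sum_eq_zero]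
      · simp
      · intro s _
        refine hf _ _ (fun j hj => ?_) ha
        simp [hk j hj, show j ≠ i by omega, show j ≠ i + 1 by omega]
      · intro j hj
        simp [Equiv.swap_apply_of_ne_of_ne (show j ≠ i by omega) (show j ≠ i + 1 by omega), hk j hj]
      · intro j hj
        simp [Equiv.swap_apply_of_ne_of_ne (show j ≠ i by omega) (show j ≠ i + 1 by omega), ha j hj]
    · change f (k + Pi.single l s, a) = 0
      refine hf _ _ (fun j hj => ?_) ha
      simp [hk j hj, show j ≠ l by omega]
  | algebraMap r =>
    intro k a hk ha
    rw [Module.algebraMap_end_apply, Pi.smul_apply, hf k a hk ha, smul_zero]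
  | add x y _ _ h1 h2 =>
    intro k a hk ha
    rw [LinearMap.add_apply, Pi.add_apply, h1 f hf k a hk ha, h2 f hf k a hk ha, add_zero]
  | mul x y _ _ h1 h2 =>
    exact h1 (y f) (h2 f hf)

theorem tau_opT_last {n : ℕ} {h : Module.End A (Mod d A)} (hh : h ∈ opAlg c κ n) (s : ZMod d)
    (hs : s ≠ 0) : tau (h * opT n s) = 0 := by
  refine opAlg_vanish c κ hh (opT n s vac) ?_ 0 1 (fun _ _ => rfl) fun _ _ => rfl
  intro k a hk ha
  change (vac : Mod d A) (k + Pi.single n s, a) = 0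
  classical
  rw [vac_apply, if_neg]
  rintro ⟨h, -⟩
  have := congrFun h n
  simp [hk n le_rfl] at this
  exact hs this

theorem tau_opG_last {n : ℕ} {h : Module.End A (Mod d A)} (hh : h ∈ opAlg c κ (n + 1))
    (s : ZMod d) : tau (h * opT (n + 1) s * opG c κ n) = 0 := by
  refine opAlg_vanish c κ hh (opT (n + 1) s (opG c κ n vac)) ?_ 0 1
    (fun _ _ => rfl) fun _ _ => rfl
  intro k a hk ha
  change opG c κ n (vac : Mod d A) (k + Pi.single (n + 1) s, a) = 0
  rw [opG_apply, opE_apply]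
  by_cases h1 : a = 1
  · subst h1
    have : (1 : Equiv.Perm ℕ) * Equiv.swap n (n + 1) ≠ 1 := by
      rw [one_mul]; intro h
      have := congrArg (fun e : Equiv.Perm ℕ => e n) h
      simp at this
    rw [vac_ne _ this]
    simp
  · have h2 : a * Equiv.swap n (n + 1) ≠ 1 := by
      intro h
      have := congrArg (fun e : Equiv.Perm ℕ => e n) h
      simp [ha (n + 1) le_rfl] at this
    simp [vac_ne _ h1, vac_ne _ h2]

theorem opE_opT_swap (i j : ℕ) (s : ZMod d) :
    (opE κ i (i + 1) * opT (Equiv.swap i (i + 1) j) s : Module.End A (Mod d A))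
      = opE κ i (i + 1) * opT j s := by
  by_cases hi : j = i
  · subst hi; rw [Equiv.swap_apply_left, opE_opT]
  by_cases hi' : j = i + 1
  · subst hi'; rw [Equiv.swap_apply_right, opE_opT]
  rw [Equiv.swap_apply_of_ne_of_ne hi hi']

theorem opE_opG_self (i : ℕ) :
    (opG c κ i * opE κ i (i + 1) : Module.End A (Mod d A)) = opE κ i (i + 1) * opG c κ i := by
  rw [opE_opG, Equiv.swap_apply_left, Equiv.swap_apply_right, opE_symm]

theorem opT_opG (i j : ℕ) (s : ZMod d) :
    (opT j s * opG c κ i : Module.End A (Mod d A))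
      = opG c κ i * opT (Equiv.swap i (i + 1) j) s := by
  rw [opG_opT, Equiv.swap_apply_self]

theorem opG_commute_opAlg {n i : ℕ} (h : n ≤ i) {y : Module.End A (Mod d A)}
    (hy : y ∈ opAlg c κ n) : Commute y (opG c κ i) := by
  refine opAlg_commute c κ (fun j hj => opG_far c κ j i (by omega)) (fun j s hj => ?_) hy
  have := opG_opT (A := A) c κ i j s
  rw [Equiv.swap_apply_of_ne_of_ne (by omega) (by omega)] at this
  exact this.symm

theorem opT_commute_opAlg {n i : ℕ} (h : n ≤ i) (s : ZMod d) {y : Module.End A (Mod d A)}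
    (hy : y ∈ opAlg c κ n) : Commute y (opT i s) := by
  refine opAlg_commute c κ (fun j hj => ?_) (fun j r hj => opT_comm _ _ _ _) hy
  have := opG_opT (A := A) c κ j i s
  rw [Equiv.swap_apply_of_ne_of_ne (by omega) (by omega)] at this
  exact this

/-- Jucys--Murphy operators. -/
def opL : ℕ → Module.End A (Mod d A)
  | 0 => 0
  | n + 1 => opG c κ n * opL n * opG c κ n + opE κ n (n + 1) * opG c κ n

theorem opL_mem (n : ℕ) : (opL c κ n : Module.End A (Mod d A)) ∈ opAlg c κ (n + 1) := by
  induction n with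
  | zero => exact Subalgebra.zero_mem _
  | succ n ih =>
    have hG : (opG c κ n : Module.End A (Mod d A)) ∈ opAlg c κ (n + 1 + 1) :=
      opG_mem c κ (by omega)
    exact Subalgebra.add_mem _ (Subalgebra.mul_mem _ (Subalgebra.mul_mem _ hG
      (opAlg_mono c κ (by omega) ih)) hG)
      (Subalgebra.mul_mem _ (opE_mem c κ (by omega) (by omega)) hG)

theorem opT_opL (n j : ℕ) (s : ZMod d) :
    (opT j s * opL c κ n : Module.End A (Mod d A)) = opL c κ n * opT j s := by
  induction n generalizing j with
  | zero => simp [opL]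
  | succ n ih =>
    rw [opL, mul_add, add_mul]
    congr 1
    · rw [← mul_assoc, ← mul_assoc, opT_opG, mul_assoc (opG c κ n), ih, mul_assoc, mul_assoc,
        ← opG_opT]
      simp only [mul_assoc]
    · rw [← mul_assoc, opT_opE, mul_assoc, opT_opG, ← mul_assoc, ← opE_opG_self, mul_assoc,
        opE_opT_swap, ← mul_assoc]

theorem opE_opL (n i j : ℕ) :
    (opE κ i j * opL c κ n : Module.End A (Mod d A)) = opL c κ n * opE κ i j := by
  simp only [opE, mul_smul_comm, smul_mul_assoc, Finset.mul_sum, Finset.sum_mul]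
  congr 1
  refine Finset.sum_congr rfl fun r _ => ?_
  rw [mul_assoc, opT_opL, ← mul_assoc, opT_opL, mul_assoc]

section
variable {κ}

theorem opG_opL (hκ : κ * d = 1) (i n : ℕ) (h : i + 1 < n) :
    (opG c κ i * opL c κ n : Module.End A (Mod d A)) = opL c κ n * opG c κ i := by
  induction n with
  | zero => omega
  | succ n ih =>
    by_cases hi : i + 1 < n
    · have h1 : Commute (opG c κ i) (opG c κ n : Module.End A (Mod d A)) := opG_far c κ i n hi
      have h2 : Commute (opG c κ i) (opE κ n (n + 1) : Module.End A (Mod d A)) := by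
        have := opE_opG (A := A) (d := d) c κ n (n + 1) i
        rwa [Equiv.swap_apply_of_ne_of_ne (by omega) (by omega),
          Equiv.swap_apply_of_ne_of_ne (by omega) (by omega)] at this
      exact ((h1.mul_right (ih hi)).mul_right h1).add_right (h2.mul_right h1)
    · obtain rfl : n = i + 1 := by omega
      have hl : (opL c κ i * opG c κ (i + 1) : Module.End A (Mod d A))
          = opG c κ (i + 1) * opL c κ i := (opG_commute_opAlg c κ le_rfl (opL_mem c κ i)).eq
      have hbr := opG_braid (d := d) (A := A) c hκ i
      have hsq := opG_sq (d := d) (A := A) c hκ i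
      have sw : ∀ x y z : ℕ, z ≠ x → z ≠ y → Equiv.swap x y z = z :=
        fun x y z h1 h2 => Equiv.swap_apply_of_ne_of_ne h1 h2
      have be := opE_opG (d := d) (A := A) c κ i (i + 1) (i + 1)
      rw [sw _ _ i (by omega) (by omega), Equiv.swap_apply_left] at be
      have ah := opE_opG (d := d) (A := A) c κ i (i + 1 + 1) i
      rw [sw _ _ (i + 1 + 1) (by omega) (by omega), Equiv.swap_apply_left] at ah
      have af := opE_opG (d := d) (A := A) c κ (i + 1) (i + 1 + 1) i
      rw [sw _ _ (i + 1 + 1) (by omega) (by omega), Equiv.swap_apply_right] at af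
      have fe : (opE κ (i + 1) (i + 1 + 1) * opE κ i (i + 1) : Module.End A (Mod d A))
          = opE κ i (i + 1 + 1) * opE κ (i + 1) (i + 1 + 1) := by
        rw [opE_comm, opE_mul_right]
      rw [opL, opL]
      generalize (opG c κ i : Module.End A (Mod d A)) = a at *
      generalize (opG c κ (i + 1) : Module.End A (Mod d A)) = b at *
      generalize (opL c κ i : Module.End A (Mod d A)) = l at *
      generalize (opE κ i (i + 1) : Module.End A (Mod d A)) = e at *
      generalize (opE κ (i + 1) (i + 1 + 1) : Module.End A (Mod d A)) = f at *
      generalize (opE κ i (i + 1 + 1) : Module.End A (Mod d A)) = h at *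
      have E1 : a * (b * (a * l * a) * b) = b * (a * l * a) * b * a := calc
        _ = (a * b * a) * l * a * b := by simp only [mul_assoc]
        _ = b * a * (b * l) * a * b := by rw [hbr]; simp only [mul_assoc]
        _ = b * a * l * (b * a * b) := by rw [← hl]; simp only [mul_assoc]
        _ = _ := by rw [← hbr]; simp only [mul_assoc]
      have E2 : b * (e * a) * b = h * a * b * a := calc
        _ = (b * e) * a * b := by simp only [mul_assoc]
        _ = h * (b * a * b) := by rw [be]; simp only [mul_assoc]
        _ = _ := by rw [← hbr]; simp only [mul_assoc]
      have E3 : a * (h * a * b * a) = f * b * a + c • (f * e * a * b * a) := calc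
        _ = (a * h) * a * b * a := by simp only [mul_assoc]
        _ = f * (a * a) * b * a := by rw [ah]; simp only [mul_assoc]
        _ = _ := by
          rw [hsq]
          simp only [mul_add, add_mul, mul_one, mul_smul_comm, smul_mul_assoc, mul_assoc]
      have E4 : h * a * b * a * a = h * a * b + c • (h * f * a * b * a) := calc
        _ = h * a * b * (a * a) := by simp only [mul_assoc]
        _ = h * a * b + c • (h * a * (b * e) * a) := by
          rw [hsq]
          simp only [mul_add, add_mul, mul_one, mul_smul_comm, smul_mul_assoc, mul_assoc]
        _ = h * a * b + c • (h * (a * h) * b * a) := by rw [be]; simp only [mul_assoc]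
        _ = _ := by rw [ah]; simp only [mul_assoc]
      have E5 : a * (f * b) = h * a * b := by rw [← mul_assoc, af]
      rw [mul_add b, add_mul _ _ b, E2, mul_add, mul_add, add_mul, add_mul, E1, E3, E4, E5, fe]
      abel

/-- The Jucys--Murphy operator commutes with everything on the earlier strands. -/
theorem opL_commute (hκ : κ * d = 1) {n : ℕ} {y : Module.End A (Mod d A)} (hy : y ∈ opAlg c κ n) :
    Commute y (opL c κ n) :=
  opAlg_commute c κ (fun i hi => opG_opL c hκ i n hi) (fun j s _ => opT_opL c κ n j s) hy

theorem opG_opL_succ (hκ : κ * d = 1) (n : ℕ) : (opG c κ n * opL c κ (n + 1) : Module.End A (Mod d A))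
    = opL c κ n * opG c κ n + c • (opE κ n (n + 1) * opL c κ (n + 1)) + opE κ n (n + 1) := by
  have hsq := opG_sq (d := d) (A := A) c hκ n
  have hE := opE_idem (d := d) (A := A) hκ n (n + 1)
  have hEG := opE_opG_self (d := d) (A := A) c κ n
  rw [opL]
  generalize (opG c κ n : Module.End A (Mod d A)) = a at *
  generalize (opL c κ n : Module.End A (Mod d A)) = l at *
  generalize (opE κ n (n + 1) : Module.End A (Mod d A)) = e at *
  have e1 : a * (a * l * a) = l * a + c • (e * (a * l * a)) := by
    rw [← mul_assoc, ← mul_assoc, hsq]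
    simp only [mul_add, add_mul, one_mul, mul_smul_comm, smul_mul_assoc, mul_assoc]
  have e2 : a * (e * a) = e + c • (e * (e * a)) := by
    rw [← mul_assoc, hEG, mul_assoc, hsq]
    simp only [mul_add, mul_one, mul_smul_comm]
  rw [mul_add, e1, e2, mul_add, smul_add]
  abel

theorem opL_span (hκ : κ * d = 1) (m : ℕ) : (opL c κ (m + 1) : Module.End A (Mod d A)) ∈
    Submodule.span A {h | ∃ u ∈ opAlg c κ (m + 1), ∃ v ∈ opAlg c κ (m + 1), ∃ s : ZMod d,
      h = u * opT (m + 1) s * opG c κ m * v} := by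
  have hE : ∀ m : ℕ, (opE κ m (m + 1) * opG c κ m : Module.End A (Mod d A)) ∈
    Submodule.span A {h | ∃ u ∈ opAlg c κ (m + 1), ∃ v ∈ opAlg c κ (m + 1), ∃ s : ZMod d,
      h = u * opT (m + 1) s * opG c κ m * v} := by
    intro m
    rw [opE, smul_mul_assoc, Finset.sum_mul]
    refine Submodule.smul_mem _ _ (Submodule.sum_mem _ fun s _ => Submodule.subset_span ?_)
    exact ⟨_, opT_mem c κ (Nat.lt_succ_self m) s, 1, Subalgebra.one_mem _, -s, by rw [mul_one]⟩
  induction m with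
  | zero => simpa [opL] using hE 0
  | succ m ih =>
    rw [opL]
    refine Submodule.add_mem _ ?_ (hE (m + 1))
    generalize (opL c κ (m + 1) : Module.End A (Mod d A)) = l at ih
    induction ih using Submodule.span_induction with
    | mem x hx =>
      obtain ⟨u, hu, v, hv, s, rfl⟩ := hx
      have hu' := (opG_commute_opAlg c κ (le_refl (m + 1)) hu).eq
      have hv' := (opG_commute_opAlg c κ (le_refl (m + 1)) hv).eq
      have hG : (opG c κ m : Module.End A (Mod d A)) ∈ opAlg c κ (m + 1 + 1) :=
        opG_mem c κ (by omega)
      refine Submodule.subset_span ⟨u * opG c κ m,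
        Subalgebra.mul_mem _ (opAlg_mono c κ (by omega) hu) hG, opG c κ m * v,
        Subalgebra.mul_mem _ hG (opAlg_mono c κ (by omega) hv), s, ?_⟩
      have hT := opG_opT (A := A) c κ (m + 1) (m + 1) s
      rw [Equiv.swap_apply_left] at hT
      have hT' := opG_opT (A := A) c κ m (m + 1 + 1) s
      rw [Equiv.swap_apply_of_ne_of_ne (by omega) (by omega)] at hT'
      have hbr : (opG c κ m * opG c κ (m + 1) * opG c κ m : Module.End A (Mod d A))
        = opG c κ (m + 1) * opG c κ m * opG c κ (m + 1) := opG_braid c hκ m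
      calc _ = (opG c κ (m + 1) * u) * opT (m + 1) s * opG c κ m * (v * opG c κ (m + 1)) := by
            simp only [mul_assoc]
        _ = u * (opG c κ (m + 1) * opT (m + 1) s) * opG c κ m * opG c κ (m + 1) * v := by
            rw [← hu', hv']; simp only [mul_assoc]
        _ = u * opT (m + 1 + 1) s * (opG c κ (m + 1) * opG c κ m * opG c κ (m + 1)) * v := by
            rw [hT]; simp only [mul_assoc]
        _ = u * (opT (m + 1 + 1) s * opG c κ m) * opG c κ (m + 1) * opG c κ m * v := by
            rw [← hbr]; simp only [mul_assoc]
        _ = _ := by rw [← hT']; simp only [mul_assoc]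
    | zero => simp
    | add x y _ _ h1 h2 => rw [mul_add, add_mul]; exact Submodule.add_mem _ h1 h2
    | smul r x _ h1 =>
      rw [mul_smul_comm, smul_mul_assoc]; exact Submodule.smul_mem _ _ h1

theorem tau_opT_opL (hκ : κ * d = 1) {n : ℕ} {y : Module.End A (Mod d A)} (hy : y ∈ opAlg c κ n) (s : ZMod d) :
    tau (y * opT n s * opL c κ n) = 0 := by
  cases n with
  | zero => simp [opL]
  | succ n =>
    have hl := opL_span (d := d) c hκ n
    generalize (opL c κ (n + 1) : Module.End A (Mod d A)) = l at hl
    induction hl using Submodule.span_induction with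
    | mem x hx =>
      obtain ⟨u, hu, v, hv, r, rfl⟩ := hx
      have hu' := (opT_commute_opAlg c κ le_rfl s hu).eq
      have e1 : y * opT (n + 1) s * (u * opT (n + 1) r * opG c κ n * v)
        = (y * u * opT (n + 1) (s + r) * opG c κ n) * v := by
        rw [← opT_mul]
        calc _ = y * (opT (n + 1) s * u) * opT (n + 1) r * opG c κ n * v := by
              simp only [mul_assoc]
          _ = _ := by rw [← hu']; simp only [mul_assoc]
      have hm : (y * u * opT (n + 1) (s + r) * opG c κ n : Module.End A (Mod d A))
          ∈ opAlg c κ (n + 1 + 1) :=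
        Subalgebra.mul_mem _ (Subalgebra.mul_mem _
          (opAlg_mono c κ (by omega) (Subalgebra.mul_mem _ hy hu)) (opT_mem c κ (by omega) _))
          (opG_mem c κ (by omega))
      rw [e1, tau_comm c κ hm (opAlg_mono c κ (by omega) hv)]
      rw [← mul_assoc, ← mul_assoc]
      exact tau_opG_last c κ (Subalgebra.mul_mem _ hv (Subalgebra.mul_mem _ hy hu)) _
    | zero => simp
    | add x z _ _ h1 h2 => rw [mul_add, map_add, h1, h2, add_zero]
    | smul r x _ h1 => rw [mul_smul_comm, map_smul, h1, smul_zero]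

end

/-- The average of framing operators weighted by the trace parameters. -/
def opX (x : ZMod d → A) (j : ℕ) : Module.End A (Mod d A) := ∑ s : ZMod d, x s • opT j (-s)

variable (w : A) (x : ZMod d → A)

def opP (n : ℕ) : Module.End A (Mod d A) := opX x n + w • opL c κ n

def opC : ℕ → Module.End A (Mod d A)
  | 0 => 1
  | n + 1 => opC n * opP c κ w x n

theorem opX_mem {i n : ℕ} (h : i < n) : (opX x i : Module.End A (Mod d A)) ∈ opAlg c κ n :=
  Subalgebra.sum_mem _ fun s _ => Subalgebra.smul_mem _ (opT_mem c κ h (-s)) _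

theorem opP_mem (n : ℕ) : opP c κ w x n ∈ opAlg c κ (n + 1) :=
  Subalgebra.add_mem _ (opX_mem c κ x (Nat.lt_succ_self n))
    (Subalgebra.smul_mem _ (opL_mem c κ n) _)

theorem opC_mem (n : ℕ) : opC c κ w x n ∈ opAlg c κ n := by
  induction n with
  | zero => exact Subalgebra.one_mem _
  | succ n ih =>
    exact Subalgebra.mul_mem _ (opAlg_mono c κ (by omega) ih) (opP_mem c κ w x n)

theorem opT_opX (i j : ℕ) (s : ZMod d) : opT i s * opX x j = opX x j * opT i s := by
  simp only [opX, Finset.mul_sum, Finset.sum_mul, mul_smul_comm, smul_mul_assoc]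
  refine Finset.sum_congr rfl fun r _ => ?_
  rw [opT_comm]

theorem opG_opX (i j : ℕ) :
    opG c κ i * opX x j = opX x (Equiv.swap i (i + 1) j) * opG c κ i := by
  simp only [opX, Finset.mul_sum, Finset.sum_mul, mul_smul_comm, smul_mul_assoc]
  refine Finset.sum_congr rfl fun r _ => ?_
  rw [opG_opT]

theorem opE_opX (i j : ℕ) : opE κ i j * opX x i = opE κ i j * opX x j := by
  simp only [opX, Finset.mul_sum, mul_smul_comm]
  refine Finset.sum_congr rfl fun r _ => ?_
  rw [opE_opT]

theorem opX_opL (i n : ℕ) : opX x i * opL c κ n = opL c κ n * opX x i := by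
  simp only [opX, Finset.mul_sum, Finset.sum_mul, mul_smul_comm, smul_mul_assoc]
  refine Finset.sum_congr rfl fun r _ => ?_
  rw [opT_opL]

theorem opX_opE (l i j : ℕ) : opX x l * opE κ i j = opE κ i j * opX x l := by
  simp only [opX, Finset.mul_sum, Finset.sum_mul, mul_smul_comm, smul_mul_assoc]
  refine Finset.sum_congr rfl fun r _ => ?_
  rw [opT_opE]

theorem opT_opP (n j : ℕ) (s : ZMod d) :
    opT j s * opP c κ w x n = opP c κ w x n * opT j s := by
  rw [opP, mul_add, add_mul, opT_opX, mul_smul_comm, smul_mul_assoc, opT_opL]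

section
variable {κ}

theorem opP_commute (hκ : κ * d = 1) {n : ℕ} {y : Module.End A (Mod d A)} (hy : y ∈ opAlg c κ n) :
    Commute y (opP c κ w x n) := by
  refine opAlg_commute c κ (fun i hi => ?_) (fun j s _ => opT_opP c κ w x n j s) hy
  have h := opG_opX (A := A) c κ x i n
  rw [Equiv.swap_apply_of_ne_of_ne (by omega) (by omega)] at h
  have h2 := opG_opL (d := d) c hκ i n hi
  rw [commute_iff_eq, opP, mul_add, add_mul, h, mul_smul_comm, smul_mul_assoc, h2]

theorem opG_opP (hκ : κ * d = 1) (m : ℕ) : opG c κ m * (opP c κ w x m * opP c κ w x (m + 1))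
    = opP c κ w x m * opP c κ w x (m + 1) * opG c κ m := by
  have hll : opL c κ m * opL c κ (m + 1) = opL c κ (m + 1) * opL c κ m :=
    (opL_commute (d := d) c hκ (opL_mem c κ m)).eq
  have hsq := opG_sq (d := d) (A := A) c hκ m
  have hE := opE_idem (d := d) (A := A) hκ m (m + 1)
  have hEG := opE_opG_self (d := d) (A := A) c κ m
  have hEl := opE_opL (d := d) (A := A) c κ m m (m + 1)
  have hX := opG_opX c κ x m m
  rw [Equiv.swap_apply_left] at hX
  have hX' := opG_opX c κ x m (m + 1)
  rw [Equiv.swap_apply_right] at hX'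
  have hEX := opE_opX κ x m (m + 1)
  have hXl := opX_opL c κ x m m
  have hXl' := opX_opL c κ x (m + 1) m
  have hXE := opX_opE κ x m m (m + 1)
  have hXE' := opX_opE κ x (m + 1) m (m + 1)
  have hXX : opX x m * opX x (m + 1) = opX x (m + 1) * opX x m := by
    conv_lhs => rw [opX]
    conv_rhs => enter [2]; rw [opX]
    simp only [Finset.mul_sum, Finset.sum_mul, mul_smul_comm, smul_mul_assoc]
    exact Finset.sum_congr rfl fun r _ => by rw [opT_opX]
  rw [opP, opP]
  rw [opL] at hll ⊢
  generalize (opG c κ m : Module.End A (Mod d A)) = a at *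
  generalize (opL c κ m : Module.End A (Mod d A)) = l at *
  generalize (opE κ m (m + 1) : Module.End A (Mod d A)) = e at *
  generalize opX x m = X at *
  generalize opX x (m + 1) = Y at *
  -- the three homogeneous components
  have A0 : a * (X * Y) = X * Y * a := by
    rw [← mul_assoc, hX, mul_assoc, hX', ← mul_assoc, hXX]
  have A1 : a * (X * (a * l * a + e * a) + l * Y) = (X * (a * l * a + e * a) + l * Y) * a := by
    have B1 : a * (X * (a * l * a)) = Y * l * a + c • (Y * e * a * l * a) := calc
      _ = (a * X) * a * l * a := by simp only [mul_assoc]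
      _ = Y * (a * a) * l * a := by rw [hX]; simp only [mul_assoc]
      _ = _ := by
        rw [hsq]; simp only [mul_add, add_mul, mul_one, mul_smul_comm, smul_mul_assoc, mul_assoc]
    have B2 : a * (X * (e * a)) = Y * e * (a * a) := by
      rw [← mul_assoc, hX, mul_assoc, ← mul_assoc a e, hEG]; simp only [mul_assoc]
    have B3 : X * (a * l * a) * a = X * a * l + c • (X * a * l * e * a) := calc
      _ = X * a * l * (a * a) := by simp only [mul_assoc]
      _ = _ := by
        rw [hsq]; simp only [mul_add, add_mul, mul_one, mul_smul_comm, smul_mul_assoc, mul_assoc]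
    have B4 : X * a * l * e * a = Y * e * a * l * a := calc
      _ = X * a * (l * e) * a := by simp only [mul_assoc]
      _ = X * (a * e) * l * a := by rw [← hEl]; simp only [mul_assoc]
      _ = (X * e) * a * l * a := by rw [hEG]; simp only [mul_assoc]
      _ = _ := by rw [hXE, hEX, ← hXE']
    have B5 : X * (e * a) * a = Y * e * (a * a) := calc
      _ = (X * e) * (a * a) := by simp only [mul_assoc]
      _ = _ := by rw [hXE, hEX, ← hXE']
    have B6 : a * (l * Y) = X * a * l := by rw [← hXl', ← mul_assoc, hX']
    have B7 : l * Y * a = Y * l * a := by rw [hXl']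
    rw [mul_add, mul_add, mul_add, add_mul, add_mul, B1, B2, B3, B4, B5, B6, B7]
    abel
  have A2 : a * (l * (a * l * a + e * a)) = l * (a * l * a + e * a) * a := by
    have C1 : a * (l * (a * l * a + e * a)) = l * a * l + e * l
        + c • (e * (a * l * a * l + e * a * l)) := by
      rw [hll]
      calc _ = (a * a) * l * a * l + (a * e) * a * l := by
            simp only [mul_add, add_mul, mul_assoc]
        _ = (a * a) * l * a * l + e * (a * a) * l := by rw [hEG]; simp only [mul_assoc]
        _ = _ := by
          rw [hsq]
          simp only [mul_add, add_mul, one_mul, mul_one, mul_smul_comm, smul_mul_assoc, mul_assoc,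
            smul_add]
          abel
    have C2 : l * (a * l * a + e * a) * a = l * a * l + e * l
        + c • (e * (l * a * l * a + e * l * a)) := by
      calc _ = l * a * l * (a * a) + (l * e) * (a * a) := by
            simp only [mul_add, add_mul, mul_assoc]
        _ = l * a * l * (1 + c • (e * a)) + e * l * (1 + c • (e * a)) := by rw [hsq, ← hEl]
        _ = l * a * l + e * l + c • (l * a * (l * e) * a + e * (l * e) * a) := by
          simp only [mul_add, add_mul, mul_one, mul_smul_comm, smul_mul_assoc, mul_assoc,
            smul_add]
          abel
        _ = l * a * l + e * l + c • (l * (a * e) * l * a + e * e * l * a) := by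
          rw [← hEl]; simp only [mul_assoc]
        _ = l * a * l + e * l + c • ((l * e) * a * l * a + e * e * l * a) := by
          rw [hEG]; simp only [mul_assoc]
        _ = _ := by rw [← hEl]; simp only [mul_add, mul_assoc]
    rw [C1, C2]
    congr 3
    have h := hll
    rw [mul_add, add_mul] at h
    calc a * l * a * l + e * a * l = l * (a * l * a) + l * (e * a) := h.symm
      _ = l * a * l * a + (l * e) * a := by simp only [mul_assoc]
      _ = _ := by rw [← hEl]
  have expand : (X + w • l) * (Y + w • (a * l * a + e * a))
      = X * Y + w • (X * (a * l * a + e * a) + l * Y)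
        + (w * w) • (l * (a * l * a + e * a)) := by
    generalize a * l * a + e * a = l'
    simp only [mul_add, add_mul, mul_smul_comm, smul_mul_assoc, smul_add, smul_smul]
    abel
  rw [expand, mul_add, mul_add, add_mul, add_mul, mul_smul_comm, mul_smul_comm, smul_mul_assoc,
    smul_mul_assoc, A0, A1, A2]

theorem opC_commute (hκ : κ * d = 1) {n : ℕ} {y : Module.End A (Mod d A)} (hy : y ∈ opAlg c κ n) :
    Commute y (opC c κ w x n) := by
  refine opAlg_commute c κ (fun i hi => ?_) (fun j s _ => ?_) hy
  · clear hy
    induction n with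
    | zero => omega
    | succ n ih =>
      by_cases h : i + 1 < n
      · exact (ih h).mul_right
          (opP_commute c w x hκ (opG_mem c κ h))
      · obtain rfl : n = i + 1 := by omega
        rw [opC, opC, mul_assoc]
        exact (opG_commute_opAlg c κ le_rfl (opC_mem c κ w x i)).symm.mul_right
          (opG_opP c w x hκ i)
  · clear hy
    induction n with
    | zero => exact Commute.one_right _
    | succ n ih =>
      by_cases h : j < n
      · exact (ih h).mul_right (opT_opP c κ w x n j s)
      · exact (opT_commute_opAlg c κ (by omega) s (opC_mem c κ w x n)).symm.mul_right
          (opT_opP c κ w x n j s)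

theorem tau_opT_opP (hκ : κ * d = 1) {n : ℕ} {y : Module.End A (Mod d A)} (hy : y ∈ opAlg c κ n) (s : ZMod d) :
    tau (y * opT n s * opP c κ w x n) = x s * tau y := by
  rw [opP, mul_add, map_add, mul_smul_comm, map_smul, tau_opT_opL c hκ hy, smul_zero, add_zero,
    opX, Finset.mul_sum, map_sum]
  rw [Finset.sum_eq_single s]
  · rw [mul_smul_comm, map_smul, mul_assoc, opT_mul, add_neg_cancel, opT_zero, mul_one, smul_eq_mul]
  · intro r _ hr
    rw [mul_smul_comm, map_smul, mul_assoc, opT_mul, tau_opT_last c κ hy, smul_zero]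
    intro h
    exact hr (by rw [← sub_eq_add_neg, sub_eq_zero] at h; exact h.symm)
  · simp

theorem tau_opG_opP (hκ : κ * d = 1) {n : ℕ} {y : Module.End A (Mod d A)} (hy : y ∈ opAlg c κ (n + 1)) :
    tau (y * opG c κ n * opP c κ w x (n + 1)) = w * κ * tau y := by
  have hX : tau (y * opG c κ n * opX x (n + 1)) = 0 := by
    rw [mul_assoc, opG_opX, Equiv.swap_apply_right, opX, Finset.sum_mul, Finset.mul_sum, map_sum]
    refine Finset.sum_eq_zero fun s _ => ?_
    rw [smul_mul_assoc, mul_smul_comm, map_smul, ← mul_assoc]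
    have := tau_opG_last c κ
      (Subalgebra.mul_mem _ hy (opT_mem c κ (Nat.lt_succ_self n) (-s))) (0 : ZMod d)
    rw [opT_zero, mul_one] at this
    rw [this, smul_zero]
  have hE : ∀ u : Module.End A (Mod d A),
      y * (opE κ n (n + 1) * u) = κ • ∑ s : ZMod d, (y * opT n s) * opT (n + 1) (-s) * u := by
    intro u
    rw [opE, smul_mul_assoc, mul_smul_comm, Finset.sum_mul, Finset.mul_sum]
    simp only [mul_assoc]
  have h1 : tau (y * (opL c κ n * opG c κ n)) = 0 := by
    have := tau_opG_last c κ (Subalgebra.mul_mem _ hy (opL_mem c κ n)) (0 : ZMod d)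
    rwa [opT_zero, mul_one, mul_assoc] at this
  have h2 : tau (y * (opE κ n (n + 1) * opL c κ (n + 1))) = 0 := by
    rw [hE, map_smul, map_sum, Finset.sum_eq_zero, smul_zero]
    intro s _
    exact tau_opT_opL c hκ (Subalgebra.mul_mem _ hy (opT_mem c κ (Nat.lt_succ_self n) s)) (-s)
  have h3 : tau (y * opE κ n (n + 1)) = κ * tau y := by
    have := hE 1
    rw [mul_one] at this
    rw [this, map_smul, map_sum, Finset.sum_eq_single 0]
    · simp [opT_zero]
    · intro s _ hs
      rw [mul_one]
      exact tau_opT_last c κ (Subalgebra.mul_mem _ hy (opT_mem c κ (Nat.lt_succ_self n) s)) (-s)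
        (neg_ne_zero.mpr hs)
    · simp
  rw [opP, mul_add, map_add, hX, zero_add, mul_smul_comm, map_smul, mul_assoc,
    opG_opL_succ c hκ, mul_add, mul_add, map_add, map_add, h1, mul_smul_comm, map_smul, h2, h3]
  simp [mul_assoc]

/-! The functional `h ↦ tau (h * opC n)` on the operators on `n` strands satisfies the rules of
the Markov trace. -/

theorem trace_comm (hκ : κ * d = 1) {n : ℕ} {h y : Module.End A (Mod d A)} (hh : h ∈ opAlg c κ n)
    (hy : y ∈ opAlg c κ n) :
    tau (h * y * opC c κ w x n) = tau (y * h * opC c κ w x n) := by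
  have hC := opC_mem c κ w x n
  rw [mul_assoc, tau_comm c κ hh (Subalgebra.mul_mem _ hy hC), mul_assoc, mul_assoc,
    (opC_commute c w x hκ hh).eq]

theorem trace_framing (hκ : κ * d = 1) {n : ℕ} {h : Module.End A (Mod d A)} (hh : h ∈ opAlg c κ n) (s : ZMod d) :
    tau (h * opT n s * opC c κ w x (n + 1)) = x s * tau (h * opC c κ w x n) := by
  have hC := opC_mem c κ w x n
  rw [← tau_opT_opP c w x hκ (Subalgebra.mul_mem _ hh hC), opC]
  have := (opT_commute_opAlg c κ le_rfl s hC).eq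
  rw [mul_assoc h (opC c κ w x n), this]
  simp only [mul_assoc]

theorem trace_markov (hκ : κ * d = 1) {n : ℕ} {h : Module.End A (Mod d A)} (hh : h ∈ opAlg c κ (n + 1)) :
    tau (h * opG c κ n * opC c κ w x (n + 2)) = w * κ * tau (h * opC c κ w x (n + 1)) := by
  have hC := opC_mem c κ w x (n + 1)
  rw [opC, (opP_commute c w x hκ hC).eq, ← mul_assoc]
  have hm : h * opG c κ n * opP c κ w x (n + 1) ∈ opAlg c κ (n + 2) :=
    Subalgebra.mul_mem _ (Subalgebra.mul_mem _ (opAlg_mono c κ (by omega) hh)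
      (opG_mem c κ (by omega))) (opP_mem c κ w x (n + 1))
  rw [tau_comm c κ hm (opAlg_mono c κ (by omega) hC), ← mul_assoc, ← mul_assoc,
    tau_opG_opP c w x hκ (Subalgebra.mul_mem _ hC hh), tau_comm c κ hC hh]

end

end Model

section Existence

variable (d : ℕ) [NeZero d] (q : ℂ)

abbrev OpEnd : Type := Module.End (Polynomial ℂ) (Mod d (Polynomial ℂ))

theorem C_smul_op (r : ℂ) (u : OpEnd d) : Polynomial.C r • u = r • u := by
  ext f p
  simp

def parC : Polynomial ℂ := Polynomial.C (q - q⁻¹)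

def parK : Polynomial ℂ := Polynomial.C (1 / (d : ℂ))

theorem parK_mul : parK d * (d : Polynomial ℂ) = 1 := by
  have hd : (d : ℂ) ≠ 0 := Nat.cast_ne_zero.mpr (NeZero.ne d)
  rw [parK, ← Polynomial.C_eq_natCast, ← Polynomial.C_mul, one_div, inv_mul_cancel₀ hd,
    Polynomial.C_1]

theorem opG_mul_inv (i : ℕ) : (opG (parC q) (parK d) i *
    (opG (parC q) (parK d) i - parC q • opE (parK d) i (i + 1)) : OpEnd d) = 1 := by
  rw [mul_sub, opG_sq _ (parK_mul d), mul_smul_comm, opE_opG_self, add_sub_cancel_right]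

theorem opG_inv_mul (i : ℕ) : ((opG (parC q) (parK d) i - parC q • opE (parK d) i (i + 1)) *
    opG (parC q) (parK d) i : OpEnd d) = 1 := by
  rw [sub_mul, opG_sq _ (parK_mul d), smul_mul_assoc, add_sub_cancel_right]

theorem opT_mul_neg (j : ℕ) (s : ZMod d) : (opT j s * opT j (-s) : OpEnd d) = 1 := by
  rw [opT_mul, add_neg_cancel, opT_zero]

/-- The action of the generators. -/
def repGen (n : ℕ) : FramedGen n → (OpEnd d)ˣ
  | .sigma i _ => ⟨opG (parC q) (parK d) i,
      opG (parC q) (parK d) i - parC q • opE (parK d) i (i + 1), opG_mul_inv d q i,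
      opG_inv_mul d q i⟩
  | .t j => ⟨opT j 1, opT j (-1), opT_mul_neg d j 1, by simpa using opT_mul_neg d j (-1)⟩

theorem repGen_sigma (n i : ℕ) (hi : i + 1 < n) :
    (FreeGroup.lift (repGen d q n) (freeSigma i hi) : OpEnd d) = opG (parC q) (parK d) i := by
  simp [freeSigma, repGen]

theorem repGen_t (n : ℕ) (j : Fin n) :
    (FreeGroup.lift (repGen d q n) (freeT j) : OpEnd d) = opT j 1 := by
  simp [freeT, repGen]

/-- The regular representation of the modular framed braid group. -/
def repGroup (n : ℕ) : ModularFramedBraidGroup d n →* (OpEnd d)ˣ :=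
  PresentedGroup.toGroup (f := repGen d q n) (by
    intro x hx
    have hκ := parK_mul d
    rcases hx with hx | ⟨j, rfl⟩
    · cases hx with
      | braid i j hi hj hij =>
        rw [map_mul, map_inv, mul_inv_eq_one, Units.ext_iff]
        simp only [map_mul, Units.val_mul, repGen_sigma]
        rcases hij with rfl | rfl
        · exact opG_braid _ hκ i
        · exact (opG_braid _ hκ j).symm
      | far i j hi hj hij =>
        rw [map_mul, map_inv, mul_inv_eq_one, Units.ext_iff]
        simp only [map_mul, Units.val_mul, repGen_sigma]
        rcases hij with h | h
        · exact opG_far _ _ i j h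
        · exact (opG_far _ _ j i h).symm
      | framing i j =>
        rw [map_mul, map_inv, mul_inv_eq_one, Units.ext_iff]
        simp only [map_mul, Units.val_mul, repGen_t]
        exact opT_comm _ _ _ _
      | mixed i hi j =>
        rw [map_mul, map_inv, mul_inv_eq_one, Units.ext_iff]
        simp only [map_mul, Units.val_mul, repGen_t, repGen_sigma]
        rw [opT_opG]
        congr 2
        simp only [strandSwap, Equiv.swap_apply_def, Fin.ext_iff]
        split_ifs <;> rfl
    · rw [map_pow, Units.ext_iff, Units.val_pow_eq_pow_val, repGen_t, opT_pow]
      simp [opT_zero])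

/-- The regular representation of the group algebra. -/
def repAlg (n : ℕ) : MonoidAlgebra ℂ (ModularFramedBraidGroup d n) →ₐ[ℂ] OpEnd d :=
  MonoidAlgebra.lift ℂ _ _ ((Units.coeHom _).comp (repGroup d q n))

theorem repAlg_of (n : ℕ) (g : ModularFramedBraidGroup d n) :
    repAlg d q n (MonoidAlgebra.of ℂ _ g) = repGroup d q n g := by
  simp [repAlg]

theorem repGroup_t (n : ℕ) (j : Fin n) : (repGroup d q n (modT d j) : OpEnd d) = opT j 1 := by
  simp [repGroup, modT, repGen]

theorem repGroup_sigma (n i : ℕ) (hi : i + 1 < n) :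
    (repGroup d q n (PresentedGroup.of (.sigma i hi)) : OpEnd d) = opG (parC q) (parK d) i := by
  simp [repGroup, repGen]

theorem sum_Icc_zmod {M : Type*} [AddCommMonoid M] (F : ZMod d → M) :
    ∑ s ∈ Finset.Icc 1 d, F s = ∑ s : ZMod d, F s := by
  refine Finset.sum_bij (fun s _ => (s : ZMod d)) (fun _ _ => Finset.mem_univ _) ?_ ?_
    (fun _ _ => rfl)
  · intro a ha b hb hab
    rw [Finset.mem_Icc] at ha hb
    rw [ZMod.natCast_eq_natCast_iff] at hab
    have h1 : a ≡ b [ZMOD d] := (Int.natCast_modEq_iff).mpr hab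
    obtain ⟨k, hk⟩ := h1.dvd
    have : k < 1 := by
      by_contra h
      have : (d : ℤ) * 1 ≤ d * k := by gcongr; omega
      omega
    have : -1 < k := by
      by_contra h
      have : (d : ℤ) * k ≤ d * (-1) := by gcongr; omega
      omega
    obtain rfl : k = 0 := by omega
    omega
  · intro b _
    by_cases hb : b = 0
    · exact ⟨d, Finset.mem_Icc.mpr ⟨NeZero.one_le, le_rfl⟩, by simp [hb]⟩
    · refine ⟨b.val, Finset.mem_Icc.mpr ⟨?_, (ZMod.val_lt b).le⟩, by simp⟩
      exact Nat.one_le_iff_ne_zero.mpr ((ZMod.val_ne_zero b).mpr hb)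

theorem repAlg_algE (n i : ℕ) (hi : i + 1 < n) :
    repAlg d q n (algE d i hi) = opE (parK d) i (i + 1) := by
  rw [algE, map_smul, map_sum, opE, parK, ← sum_Icc_zmod d]
  simp only [repAlg_of]
  have h1 : ∀ s : ℕ, ((repGroup d q n (modT d ⟨i, Nat.lt_of_succ_lt hi⟩ ^ s *
      (modT d ⟨i + 1, hi⟩ ^ s)⁻¹) : (OpEnd d)ˣ) : OpEnd d)
      = opT i (s : ZMod d) * opT (i + 1) (-(s : ZMod d)) := by
    intro s
    rw [map_mul, map_inv, map_pow, Units.val_mul, Units.val_pow_eq_pow_val, repGroup_t,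
      opT_pow, mul_one]
    congr 1
    refine Units.inv_eq_of_mul_eq_one_right ?_
    rw [map_pow, Units.val_pow_eq_pow_val, repGroup_t, opT_pow, mul_one]
    exact opT_mul_neg d (i + 1) s
  simp only [h1]
  ext f p
  simp

/-- The regular representation of the Yokonuma--Hecke algebra. -/
def rep (n : ℕ) : YHAlgebra d n q →ₐ[ℂ] OpEnd d :=
  RingQuot.liftAlgHom ℂ ⟨repAlg d q n, by
    rintro _ _ ⟨i, hi⟩
    rw [map_pow, map_add, map_one, map_smul, map_mul, repAlg_algE, algSigma, repAlg_of,
      repGroup_sigma, sq, opG_sq _ (parK_mul d)]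
    congr 1
    exact C_smul_op d _ _⟩

theorem rep_toYH (n : ℕ) (a : MonoidAlgebra ℂ (ModularFramedBraidGroup d n)) :
    rep d q n (toYH d n q a) = repAlg d q n a := by
  simp [rep, toYH]

theorem rep_genG (n i : ℕ) (hi : i + 1 < n) :
    rep d q n (genG d q i hi) = opG (parC q) (parK d) i := by
  rw [genG, rep_toYH, algSigma, repAlg_of, repGroup_sigma]

theorem rep_genT (n : ℕ) (j : Fin n) : rep d q n (genT d q j) = opT j 1 := by
  rw [genT, rep_toYH, repAlg_of, repGroup_t]

theorem rep_incl (n : ℕ) (a : YHAlgebra d n q) :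
    rep d q (n + 1) (incl d n q a) = rep d q n a := by
  have : (rep d q (n + 1)).comp (incl d n q) = rep d q n := by
    refine RingQuot.ringQuot_ext' (S := ℂ) (s := QuadraticRel d n q) _ _ ?_
    refine MonoidAlgebra.algHom_ext (fun g => ?_) (by ext)
    have hg : (repGroup d q (n + 1)).comp (ModularFramedBraidGroup.shift d 0 (by omega))
        = repGroup d q n := by
      refine PresentedGroup.ext fun x => ?_
      cases x <;> simp [repGroup, ModularFramedBraidGroup.shift, shiftGen, repGen]
    have h1 := repAlg_of d q n g
    have h2 := repAlg_of d q (n + 1) (ModularFramedBraidGroup.shift d 0 (by omega) g)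
    rw [← hg] at h1
    simp only [MonoidAlgebra.of_apply] at h1 h2
    simp [incl, rep, h1]
    exact (rep_toYH d q (n + 1) _).trans h2
  exact DFunLike.congr_fun this a

theorem rep_mem (n : ℕ) (a : YHAlgebra d n q) :
    rep d q n a ∈ opAlg (parC q) (parK d) n := by
  obtain ⟨b, rfl⟩ := RingQuot.mkAlgHom_surjective ℂ (QuadraticRel d n q) a
  change rep d q n (toYH d n q b) ∈ _
  rw [rep_toYH]
  have hgrp : ∀ g : ModularFramedBraidGroup d n,
      (repGroup d q n g : OpEnd d) ∈ opAlg (parC q) (parK d) n ∧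
      (((repGroup d q n g)⁻¹ : (OpEnd d)ˣ) : OpEnd d) ∈ opAlg (parC q) (parK d) n := by
    intro g
    have hg : g ∈ Subgroup.closure (Set.range (PresentedGroup.of (rels := {r | FramedRel n r} ∪
        {r | ∃ j : Fin n, r = freeT j ^ d}))) := by
      rw [PresentedGroup.closure_range_of]; trivial
    induction hg using Subgroup.closure_induction with
    | mem x hx =>
      obtain ⟨y, rfl⟩ := hx
      rw [repGroup, PresentedGroup.toGroup.of]
      cases y with
      | sigma i hi =>
        exact ⟨opG_mem _ _ hi, Subalgebra.sub_mem _ (opG_mem _ _ hi)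
          (Subalgebra.smul_mem _ (opE_mem _ _ (by omega) hi) _)⟩
      | t j => exact ⟨opT_mem _ _ j.2 _, opT_mem _ _ j.2 _⟩
    | one => simp [Subalgebra.one_mem]
    | mul x y _ _ h1 h2 =>
      rw [map_mul, mul_inv_rev, Units.val_mul, Units.val_mul]
      exact ⟨Subalgebra.mul_mem _ h1.1 h2.1, Subalgebra.mul_mem _ h2.2 h1.2⟩
    | inv x _ h1 =>
      rw [map_inv, inv_inv]
      exact ⟨h1.2, h1.1⟩
  induction b using MonoidAlgebra.induction_on with
  | of g => rw [repAlg_of]; exact (hgrp g).1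
  | add x y h1 h2 => rw [map_add]; exact Subalgebra.add_mem _ h1 h2
  | smul r x h1 =>
    rw [map_smul]
    rw [← C_smul_op]
    exact Subalgebra.smul_mem _ h1 _

/-- A Markov trace exists for all values of the parameters. -/
theorem exists_isMarkovTrace (x : ZMod d → ℂ) :
    ∃ tr : ∀ n : ℕ, YHAlgebra d n q →ₗ[ℂ] Polynomial ℂ, IsMarkovTrace d q x tr := by
  classical
  let x' : ZMod d → Polynomial ℂ := fun s => if s = 0 then 1 else Polynomial.C (x s)
  let w : Polynomial ℂ := Polynomial.X * (d : Polynomial ℂ)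
  let C : ℕ → OpEnd d := opC (parC q) (parK d) w x'
  have hκ := parK_mul d
  have hw : w * parK d = Polynomial.X := by
    simp only [w]; rw [mul_assoc, mul_comm _ (parK d), hκ, mul_one]
  have hx0 : x' 0 = 1 := by simp [x']
  refine ⟨fun n => (((tau (d := d) (A := Polynomial ℂ)).restrictScalars ℂ) ∘ₗ
    LinearMap.mulRight ℂ (C n)) ∘ₗ (rep d q n).toLinearMap, ?_⟩
  have key : ∀ (n : ℕ) (a : YHAlgebra d n q),
      ((((tau (d := d) (A := Polynomial ℂ)).restrictScalars ℂ) ∘ₗ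
      LinearMap.mulRight ℂ (C n)) ∘ₗ (rep d q n).toLinearMap) a = tau (rep d q n a * C n) :=
    fun _ _ => rfl
  have hcompat : ∀ (n : ℕ) (a : YHAlgebra d n q),
      tau (rep d q n a * C (n + 1)) = tau (rep d q n a * C n) := by
    intro n a
    have := trace_framing (parC q) w x' hκ (rep_mem d q n a) 0
    rwa [opT_zero, mul_one, hx0, one_mul] at this
  refine ⟨fun n a => ?_, fun n a b => ?_, fun n => ?_, fun n a => ?_, fun n a s h1 h2 => ?_⟩
  · rw [key, key, rep_incl, hcompat]
  · rw [key, key, map_mul (rep d q n), map_mul (rep d q n)]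
    exact trace_comm (parC q) w x' hκ (rep_mem d q n a) (rep_mem d q n b)
  · rw [key]
    induction n with
    | zero =>
      rw [map_one, one_mul]
      change (vac : Mod d (Polynomial ℂ)) (0, 1) = 1
      simp [vac]
    | succ n ih =>
      rw [map_one] at ih ⊢
      have := hcompat n 1
      rwa [map_one, ih] at this
  · rw [key, key, map_mul (rep d q (n + 2)), rep_incl, rep_genG]
    have := trace_markov (parC q) w x' hκ (rep_mem d q (n + 1) a)
    rw [hw] at this
    exact this
  · rw [key, key, map_mul (rep d q (n + 1)), rep_incl, map_pow (rep d q (n + 1)), rep_genT, opT_pow, mul_one]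
    have hs : (s : ZMod d) ≠ 0 := by
      rw [Ne, ZMod.natCast_eq_zero_iff]
      intro h
      have := Nat.le_of_dvd (by omega) h
      omega
    have := trace_framing (parC q) w x' hκ (rep_mem d q n a) (s : ZMod d)
    simp only [x', if_neg hs] at this
    exact this

end Existence

/-! ### The specialized trace -/

/-- The specialized trace: the family of linear maps `Y_{d,n}(q) → ℂ[z]` that satisfies the rules
of the Markov trace with the parameters `x₁, …, x_{d-1}` (it is the only one, because the rules
determine it on the inductive basis). -/
def specializedTrace (d : ℕ) [NeZero d] (q : ℂ) (x : ZMod d → ℂ) (n : ℕ) :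
    YHAlgebra d n q →ₗ[ℂ] Polynomial ℂ :=
  (exists_isMarkovTrace d q x).choose n

theorem specializedTrace_spec (d : ℕ) [NeZero d] (q : ℂ) (x : ZMod d → ℂ) :
    IsMarkovTrace d q x (specializedTrace d q x) :=
  (exists_isMarkovTrace d q x).choose_spec

end YokonumaHecke

end

/-! In `connectedSum α β` the last strand of α and the first strand of β become the same strand. The
only test of multiplicativity is therefore what happens when framings coming from both sides meet on
that strand.

From 1 to 2: take α and β to be pure framings, the power a on the last strand of α and the power b
on the first strand of β. Their connected sum is the power a + b of a single framing generator, so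
multiplicativity of the trace says x_{a+b} = x_a x_b. Hence x_k = x_1^k for every natural number k,
and k = d gives x_1^d = x_0 = 1.

From 2 to 1: condition 2 says that s ↦ x_s is a character of ℤ/dℤ. Under this assumption a framing
on any strand, next to any element a, only contributes a scalar: tr(a t_j) = x_1 tr(a)
(`IsMarkovTrace.mul_genT`). The identity for connected sums then follows by removing the strands of
the second factor one at a time from the far end. Each removal uses the framing rule or the Markov
rule of the trace and never touches the first factor. Once a single strand is left, the second
factor is a polynomial in the framing of the shared strand, and the scalar property finishes the
argument (`IsMarkovTrace.shiftYH_mul`).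

Both inductions need a supply of elements to which the trace rules apply. This is the spanning
theorem `span_inductiveGen`: Y_{d,n+1}(q) is the sum of the spaces Y_{d,n}(q) t_{n+1}^s and of
Y_{d,n}(q) g_n Y_{d,n}(q). Only spanning is needed, not a basis, and only the rules collected in
`IsMarkovTrace` are used, not the construction of the trace. -/

noncomputable section

namespace YokonumaHecke

/-! ### Relations in the Yokonuma--Hecke algebras -/

section Relations

variable {d : ℕ} {n : ℕ} {q : ℂ}

/-- The image in `Y_{d,n}(q)` of a modular framed braid. -/
def modularToYH (d n : ℕ) (q : ℂ) : ModularFramedBraidGroup d n →* YHAlgebra d n q :=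
  (toYH d n q : _ →* YHAlgebra d n q).comp (MonoidAlgebra.of ℂ _)

theorem modularToYH_sigma (i : ℕ) (hi : i + 1 < n) :
    modularToYH d n q (PresentedGroup.of (.sigma i hi)) = genG d q i hi := rfl

theorem modularToYH_t (j : Fin n) : modularToYH d n q (modT d j) = genT d q j := rfl

/-- The bridge from group presentation to algebra: each constructor of `FramedRel` yields an
identity between the `genG` and `genT` through this lemma. -/
theorem modularToYH_eq_of_rel {u v : FreeGroup (FramedGen n)} (h : FramedRel n (u * v⁻¹)) :
    modularToYH d n q (PresentedGroup.mk _ u) = modularToYH d n q (PresentedGroup.mk _ v) := by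
  congr 1
  have := PresentedGroup.one_of_mem
    (rels := {r | FramedRel n r} ∪ {r | ∃ j : Fin n, r = freeT j ^ d}) (Or.inl h)
  rwa [map_mul, map_inv, mul_inv_eq_one] at this

/-- Oriented as a reduction: the two occurrences of the higher generator on the left become one on
the right, which is how `span_inductiveGen` uses it. -/
theorem genG_braid (i : ℕ) (hi : i + 1 + 1 < n) :
    genG d q (i + 1) hi * genG d q i (by omega) * genG d q (i + 1) hi =
      genG d q i (by omega) * genG d q (i + 1) hi * genG d q i (by omega) := by
  have := modularToYH_eq_of_rel (d := d) (q := q)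
    (FramedRel.braid (n := n) (i + 1) i hi (by omega) (Or.inr rfl))
  simp only [map_mul] at this
  exact this

theorem genG_far (i j : ℕ) (hi : i + 1 < n) (hj : j + 1 < n) (hij : i + 1 < j ∨ j + 1 < i) :
    genG d q i hi * genG d q j hj = genG d q j hj * genG d q i hi := by
  have := modularToYH_eq_of_rel (d := d) (q := q) (FramedRel.far (n := n) i j hi hj hij)
  simp only [map_mul] at this
  exact this

theorem genT_comm (i j : Fin n) : genT d q i * genT d q j = genT d q j * genT d q i := by
  have := modularToYH_eq_of_rel (d := d) (q := q) (FramedRel.framing i j)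
  simp only [map_mul] at this
  exact this

theorem genT_mul_genG (i : ℕ) (hi : i + 1 < n) (j : Fin n) :
    genT d q j * genG d q i hi = genG d q i hi * genT d q (strandSwap i hi j) := by
  have := modularToYH_eq_of_rel (d := d) (q := q) (FramedRel.mixed i hi j)
  simp only [map_mul] at this
  exact this

theorem genG_mul_genT_left (i : ℕ) (hi : i + 1 < n) :
    genG d q i hi * genT d q ⟨i, by omega⟩ = genT d q ⟨i + 1, hi⟩ * genG d q i hi := by
  rw [genT_mul_genG, strandSwap, Equiv.swap_apply_right]

theorem genG_mul_genT_right (i : ℕ) (hi : i + 1 < n) :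
    genG d q i hi * genT d q ⟨i + 1, hi⟩ = genT d q ⟨i, by omega⟩ * genG d q i hi := by
  rw [genT_mul_genG, strandSwap, Equiv.swap_apply_left]

theorem genG_mul_genT_far (i : ℕ) (hi : i + 1 < n) (j : Fin n) (h1 : (j : ℕ) ≠ i)
    (h2 : (j : ℕ) ≠ i + 1) :
    genG d q i hi * genT d q j = genT d q j * genG d q i hi := by
  rw [genT_mul_genG, strandSwap, Equiv.swap_apply_of_ne_of_ne]
  · exact fun h => h1 (congrArg Fin.val h)
  · exact fun h => h2 (congrArg Fin.val h)

theorem modT_pow_card (j : Fin n) : modT d j ^ d = 1 := by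
  have := PresentedGroup.one_of_mem
    (rels := {r | FramedRel n r} ∪ {r | ∃ j : Fin n, r = freeT j ^ d}) (Or.inr ⟨j, rfl⟩)
  rwa [map_pow] at this

theorem genT_pow_card (j : Fin n) : genT d q j ^ d = 1 := by
  rw [← modularToYH_t, ← map_pow, modT_pow_card, map_one]

/-- The idempotent `e_i` of `Y_{d,n}(q)`. -/
def genE (d : ℕ) {n : ℕ} (q : ℂ) (i : ℕ) (hi : i + 1 < n) : YHAlgebra d n q :=
  toYH d n q (algE d i hi)

/-- Since t^d = 1, the inverse of t^s is t^(d-s), where the subtraction is not truncated because s ≤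
d. This displays the idempotent as a polynomial in the framing generators, without inverses. -/
theorem genE_eq (i : ℕ) (hi : i + 1 < n) :
    genE d q i hi = (1 / (d : ℂ)) • ∑ s ∈ Finset.Icc 1 d,
      genT d q ⟨i, by omega⟩ ^ s * genT d q ⟨i + 1, hi⟩ ^ (d - s) := by
  rw [genE, algE, map_smul, map_sum]
  congr 1
  refine Finset.sum_congr rfl fun s hs => ?_
  change modularToYH d n q _ = _
  have : (modT d (⟨i + 1, hi⟩ : Fin n) ^ s)⁻¹ = modT d ⟨i + 1, hi⟩ ^ (d - s) := by
    rw [inv_eq_iff_mul_eq_one, ← pow_add, Nat.add_sub_cancel' (Finset.mem_Icc.mp hs).2,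
      modT_pow_card]
  rw [this, map_mul, map_pow, map_pow, modularToYH_t, modularToYH_t]

theorem genG_mul_self (i : ℕ) (hi : i + 1 < n) :
    genG d q i hi * genG d q i hi = 1 + (q - q⁻¹) • (genE d q i hi * genG d q i hi) := by
  have := RingQuot.mkAlgHom_rel ℂ (QuadraticRel.quad (d := d) (n := n) (q := q) i hi)
  rw [map_pow, map_add, map_one, map_smul, map_mul] at this
  rw [← sq]
  exact this

/-- The Yokonuma--Hecke algebra is generated, as an algebra, by the `g_i` and the `t_j`. -/
theorem mem_of_generators_mem [NeZero d] (S : Subalgebra ℂ (YHAlgebra d n q))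
    (hG : ∀ i hi, genG d q i hi ∈ S) (hT : ∀ j, genT d q j ∈ S) (y : YHAlgebra d n q) :
    y ∈ S := by
  obtain ⟨b, rfl⟩ := RingQuot.mkAlgHom_surjective ℂ (QuadraticRel d n q) y
  change toYH d n q b ∈ S
  -- A subalgebra need not be closed under inverses, so membership of an element and of its inverse
  -- are carried together through the induction on the group.
  have hgrp : ∀ g : ModularFramedBraidGroup d n,
      modularToYH d n q g ∈ S ∧ modularToYH d n q g⁻¹ ∈ S := by
    intro g
    have hg : g ∈ Subgroup.closure (Set.range (PresentedGroup.of (rels := {r | FramedRel n r} ∪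
        {r | ∃ j : Fin n, r = freeT j ^ d}))) := by
      rw [PresentedGroup.closure_range_of]; trivial
    induction hg using Subgroup.closure_induction with
    | mem x hx =>
      obtain ⟨y, rfl⟩ := hx
      cases y with
      | sigma i hi =>
        refine ⟨hG i hi, ?_⟩
        have hE : genE d q i hi ∈ S := by
          rw [genE_eq]
          exact S.smul_mem (S.sum_mem fun s _ => S.mul_mem (S.pow_mem (hT _) _)
            (S.pow_mem (hT _) _)) _
        -- By the quadratic relation g - (q - q⁻¹)e is a left inverse of g. It coincides with the
        -- right inverse provided by the group.
        have : modularToYH d n q (PresentedGroup.of (.sigma i hi))⁻¹ =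
            genG d q i hi - (q - q⁻¹) • genE d q i hi := by
          have h1 : (genG d q i hi - (q - q⁻¹) • genE d q i hi) * genG d q i hi = 1 := by
            rw [sub_mul, genG_mul_self, smul_mul_assoc, add_sub_cancel_right]
          have h2 : genG d q i hi * modularToYH d n q (PresentedGroup.of (.sigma i hi))⁻¹ = 1 := by
            rw [← modularToYH_sigma, ← map_mul, mul_inv_cancel, map_one]
          exact (left_inv_eq_right_inv h1 h2).symm
        rw [this]
        exact S.sub_mem (hG i hi) (S.smul_mem hE _)
      | t j =>
        refine ⟨hT j, ?_⟩
        have : (modT d j)⁻¹ = modT d j ^ (d - 1) := by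
          rw [inv_eq_iff_mul_eq_one, ← pow_succ', Nat.sub_add_cancel NeZero.one_le, modT_pow_card]
        change modularToYH d n q (modT d j)⁻¹ ∈ S
        rw [this, map_pow]
        exact S.pow_mem (hT j) _
    | one => simp [S.one_mem]
    | mul x y _ _ h1 h2 =>
      rw [mul_inv_rev, map_mul, map_mul]
      exact ⟨S.mul_mem h1.1 h2.1, S.mul_mem h2.2 h1.2⟩
    | inv x _ h1 =>
      rw [inv_inv]
      exact ⟨h1.2, h1.1⟩
  induction b using MonoidAlgebra.induction_on with
  | of g => exact (hgrp g).1
  | add x y h1 h2 => rw [map_add]; exact S.add_mem h1 h2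
  | smul r x h1 => rw [map_smul]; exact S.smul_mem h1 _

/-! ### Inclusions, shifts and connected sums. -/

theorem incl_genG (i : ℕ) (hi : i + 1 < n) :
    incl d n q (genG d q i hi) = genG d q i (by omega) := by
  have h := mapDomain_shift_algSigma d 0 (by omega : 0 + n ≤ n + 1) i hi
  simp only [zero_add] at h
  simp only [incl, genG, toYH, RingQuot.liftAlgHom_mkAlgHom_apply, AlgHom.comp_apply]
  rw [h]

theorem incl_genT (j : Fin n) : incl d n q (genT d q j) = genT d q j.castSucc := by
  simp [incl, genT, toYH, modT, ModularFramedBraidGroup.shift, shiftGen]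
  rfl

/-- The homomorphism `Y_{d,n}(q) → Y_{d,m}(q)`, `g_i ↦ g_{r+i}`, `t_j ↦ t_{r+j}`, where
`r + n ≤ m`. -/
def shiftYH (d : ℕ) {n m : ℕ} (q : ℂ) (r : ℕ) (h : r + n ≤ m) :
    YHAlgebra d n q →ₐ[ℂ] YHAlgebra d m q :=
  RingQuot.liftAlgHom ℂ ⟨(toYH d m q).comp
    (MonoidAlgebra.mapDomainAlgHom ℂ ℂ (ModularFramedBraidGroup.shift d r h)), by
      rintro _ _ ⟨i, hi⟩
      simp only [AlgHom.comp_apply, map_pow, map_add, map_one, map_smul, map_mul,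
        mapDomain_shift_algSigma, mapDomain_shift_algE]
      have := RingQuot.mkAlgHom_rel ℂ
        (QuadraticRel.quad (d := d) (n := m) (q := q) (r + i) (by omega))
      simpa only [toYH, map_pow, map_add, map_one, map_smul, map_mul] using this⟩

theorem shiftYH_genG {m : ℕ} (r : ℕ) (h : r + n ≤ m) (i : ℕ) (hi : i + 1 < n) :
    shiftYH d q r h (genG d q i hi) = genG d q (r + i) (by omega) := by
  have h := mapDomain_shift_algSigma d r h i hi
  simp only [shiftYH, genG, toYH, RingQuot.liftAlgHom_mkAlgHom_apply, AlgHom.comp_apply]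
  rw [h]

theorem shiftYH_genT {m : ℕ} (r : ℕ) (h : r + n ≤ m) (j : Fin n) :
    shiftYH d q r h (genT d q j) = genT d q ⟨r + j, by omega⟩ := by
  simp [shiftYH, genT, toYH, modT, ModularFramedBraidGroup.shift, shiftGen]

theorem shiftYH_modularToYH {m : ℕ} (r : ℕ) (h : r + n ≤ m) (g : ModularFramedBraidGroup d n) :
    shiftYH d q r h (modularToYH d n q g) =
      modularToYH d m q (ModularFramedBraidGroup.shift d r h g) := by
  simp [shiftYH, modularToYH, toYH]

/-- Two homomorphisms from a Yokonuma--Hecke algebra that agree on the generators are equal. -/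
theorem algHom_eq_of_generators [NeZero d] {R : Type*} [Ring R] [Algebra ℂ R]
    {f g : YHAlgebra d n q →ₐ[ℂ] R} (hG : ∀ i hi, f (genG d q i hi) = g (genG d q i hi))
    (hT : ∀ j, f (genT d q j) = g (genT d q j)) (y : YHAlgebra d n q) : f y = g y :=
  mem_of_generators_mem (AlgHom.equalizer f g) hG hT y

/-- With `shiftYH_zero_succ` this serves the induction in `IsMarkovTrace.shiftYH_mul`: when the last
strand of the second factor is split off, the rest of both factors is recognised as coming from an
algebra with one strand fewer, where the trace rules expect it. -/
theorem shiftYH_incl [NeZero d] {m : ℕ} (r : ℕ) (h : r + n ≤ m) (y : YHAlgebra d n q) :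
    shiftYH d q r (by omega : r + (n + 1) ≤ m + 1) (incl d n q y) =
      incl d m q (shiftYH d q r h y) := by
  refine algHom_eq_of_generators (f := (shiftYH d q r _).comp (incl d n q))
    (g := (incl d m q).comp (shiftYH d q r h)) (fun i hi => ?_) (fun j => ?_) y
  · simp only [AlgHom.comp_apply, incl_genG, shiftYH_genG]
  · simp only [AlgHom.comp_apply, incl_genT, shiftYH_genT]
    rfl

theorem shiftYH_zero_succ [NeZero d] {m : ℕ} (h : n ≤ m) (y : YHAlgebra d n q) :
    shiftYH d q 0 (by omega : 0 + n ≤ m + 1) y = incl d m q (shiftYH d q 0 (by omega) y) := by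
  refine algHom_eq_of_generators (f := shiftYH d q 0 _)
    (g := (incl d m q).comp (shiftYH d q 0 (by omega))) (fun i hi => ?_) (fun j => ?_) y
  · simp only [AlgHom.comp_apply, incl_genG, shiftYH_genG]
  · simp only [AlgHom.comp_apply, incl_genT, shiftYH_genT]
    rfl

theorem shiftYH_zero_self [NeZero d] (y : YHAlgebra d n q) :
    shiftYH d q 0 (by omega : 0 + n ≤ n) y = y := by
  refine algHom_eq_of_generators (f := shiftYH d q 0 _) (g := AlgHom.id ℂ _)
    (fun i hi => ?_) (fun j => ?_) y
  · simp only [shiftYH_genG, zero_add, AlgHom.id_apply]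
  · simp only [shiftYH_genT, zero_add, AlgHom.id_apply]

theorem toModular_shift {m : ℕ} (r : ℕ) (h : r + n ≤ m) (α : FramedBraidGroup n) :
    toModular d m (FramedBraidGroup.shift r h α) =
      ModularFramedBraidGroup.shift d r h (toModular d n α) := by
  have : (toModular d m).comp (FramedBraidGroup.shift r h) =
      (ModularFramedBraidGroup.shift d r h).comp (toModular d n) :=
    PresentedGroup.ext fun x => by
      simp [toModular, FramedBraidGroup.shift, ModularFramedBraidGroup.shift]
  exact DFunLike.congr_fun this α

theorem braidToYH_t_pow (j : Fin n) (s : ℕ) :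
    braidToYH d q (PresentedGroup.of (.t j) ^ s : FramedBraidGroup n) = genT d q j ^ s := by
  change modularToYH d n q (toModular d n _) = _
  rw [map_pow, map_pow]
  simp [toModular, ← modularToYH_t, modT]

/-- Turns a statement about framed braids into one about arbitrary algebra elements, which is what
induction on a linear spanning set requires. With strands numbered from 0, α occupies the strands 0,
…, n and β the strands n, …, n + m; they share strand n. -/
theorem braidToYH_connectedSum {m : ℕ} (α : FramedBraidGroup (n + 1))
    (β : FramedBraidGroup (m + 1)) :
    braidToYH d q (connectedSum α β) =
      shiftYH d q 0 (by omega) (braidToYH d q α) * shiftYH d q n (by omega) (braidToYH d q β) := by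
  change modularToYH d _ q (toModular d _ _) = shiftYH d q 0 _ (modularToYH d _ q _) *
    shiftYH d q n _ (modularToYH d _ q _)
  rw [shiftYH_modularToYH, shiftYH_modularToYH, connectedSum, map_mul, map_mul, toModular_shift,
    toModular_shift]

end Relations

/-! ### The inductive spanning set -/

section Spanning

variable {d : ℕ} [NeZero d] {q : ℂ}

/-- The elements `u t_{n+1}^s` and `u g_n v` of `Y_{d,n+1}(q)`, where `u` and `v` belong to
`Y_{d,n}(q)`. -/
inductive InductiveGen (d n : ℕ) (q : ℂ) : YHAlgebra d (n + 1) q → Prop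
  | framing (u : YHAlgebra d n q) (s : ℕ) :
      InductiveGen d n q (incl d n q u * genT d q (Fin.last n) ^ s)
  -- With generators numbered from 0, the last crossing on n + 1 strands has index n - 1. The
  -- equation `hn` avoids this subtraction and leaves no element of this kind when n = 0.
  | braiding (u v : YHAlgebra d n q) (i : ℕ) (hi : i + 1 < n + 1) (hn : i + 1 = n) :
      InductiveGen d n q (incl d n q u * genG d q i hi * incl d n q v)

/-- The elements u with this property form a subalgebra, the preimage of a centralizer, so it is
enough to test the generators; these do not involve the last strand. -/
theorem commute_incl_genT (n : ℕ) (u : YHAlgebra d n q) :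
    Commute (incl d n q u) (genT d q (Fin.last n)) := by
  have h := mem_of_generators_mem
    ((Subalgebra.centralizer ℂ {genT d q (Fin.last n)}).comap (incl d n q)) (fun i hi => ?_)
    (fun j => ?_) u
  · exact (Subalgebra.mem_centralizer_iff ℂ |>.mp h _ rfl).symm
  · rw [Subalgebra.mem_comap, Subalgebra.mem_centralizer_iff]
    rintro _ rfl
    rw [incl_genG, genG_mul_genT_far] <;> simp <;> omega
  · rw [Subalgebra.mem_comap, Subalgebra.mem_centralizer_iff]
    rintro _ rfl
    rw [incl_genT, genT_comm]

/-- Same centralizer argument: u lives on the strands 0, …, n - 1, disjoint from the strands n and n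
+ 1 that are crossed. -/
theorem commute_incl_incl_genG (n : ℕ) (u : YHAlgebra d n q) :
    Commute (incl d (n + 1) q (incl d n q u)) (genG d q n (by omega)) := by
  have h := mem_of_generators_mem
    ((Subalgebra.centralizer ℂ {genG d q n (by omega)}).comap
      ((incl d (n + 1) q).comp (incl d n q))) (fun i hi => ?_)
    (fun j => ?_) u
  · exact (Subalgebra.mem_centralizer_iff ℂ |>.mp h _ rfl).symm
  · rw [Subalgebra.mem_comap, Subalgebra.mem_centralizer_iff]
    rintro _ rfl
    rw [AlgHom.comp_apply, incl_genG, incl_genG, genG_far]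
    omega
  · rw [Subalgebra.mem_comap, Subalgebra.mem_centralizer_iff]
    rintro _ rfl
    rw [AlgHom.comp_apply, incl_genT, incl_genT, genG_mul_genT_far] <;> simp <;> omega

theorem one_mem_span_inductiveGen {n : ℕ} :
    (1 : YHAlgebra d (n + 1) q) ∈ Submodule.span ℂ {y | InductiveGen d n q y} := by
  have := Submodule.subset_span (R := ℂ) (s := {y | InductiveGen d n q y})
    (InductiveGen.framing 1 0)
  rwa [map_one, pow_zero, mul_one] at this

/-- With `mul_incl_mem`, the span is a bimodule over the algebra on n strands. Writing the claim as
an inclusion into a `comap` reduces it to the spanning elements, where w is absorbed into a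
neighbouring factor. -/
theorem incl_mul_mem {n : ℕ} (w : YHAlgebra d n q) {y : YHAlgebra d (n + 1) q}
    (hy : y ∈ Submodule.span ℂ {y | InductiveGen d n q y}) :
    incl d n q w * y ∈ Submodule.span ℂ {y | InductiveGen d n q y} := by
  revert y
  change _ ≤ (Submodule.span ℂ _).comap (LinearMap.mulLeft ℂ (incl d n q w))
  rw [Submodule.span_le]
  rintro _ (⟨u, s⟩ | ⟨u, v, i, hi, hn⟩) <;> refine Submodule.subset_span ?_ <;>
    rw [LinearMap.mulLeft_apply] <;> simp only [← mul_assoc, ← map_mul]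
  · exact .framing _ _
  · exact .braiding _ _ _ _ hn

theorem mul_incl_mem {n : ℕ} (w : YHAlgebra d n q) {y : YHAlgebra d (n + 1) q}
    (hy : y ∈ Submodule.span ℂ {y | InductiveGen d n q y}) :
    y * incl d n q w ∈ Submodule.span ℂ {y | InductiveGen d n q y} := by
  revert y
  change _ ≤ (Submodule.span ℂ _).comap (LinearMap.mulRight ℂ (incl d n q w))
  rw [Submodule.span_le]
  rintro _ (⟨u, s⟩ | ⟨u, v, i, hi, hn⟩) <;> refine Submodule.subset_span ?_ <;>
    rw [LinearMap.mulRight_apply]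
  · rw [mul_assoc, ← ((commute_incl_genT n w).pow_right s).eq, ← mul_assoc, ← map_mul]
    exact .framing _ _
  · rw [mul_assoc, ← map_mul]
    exact .braiding _ _ _ _ hn

/-- The last framing passes u freely. In u g v it then crosses g, becoming the framing of the
previous strand, which is absorbed into v. -/
theorem genT_last_mul_mem {n : ℕ} {y : YHAlgebra d (n + 1) q}
    (hy : y ∈ Submodule.span ℂ {y | InductiveGen d n q y}) :
    genT d q (Fin.last n) * y ∈ Submodule.span ℂ {y | InductiveGen d n q y} := by
  revert y
  change _ ≤ (Submodule.span ℂ _).comap (LinearMap.mulLeft ℂ (genT d q (Fin.last n)))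
  rw [Submodule.span_le]
  rintro _ (⟨u, s⟩ | ⟨u, v, i, hi, hn⟩) <;> refine Submodule.subset_span ?_ <;>
    rw [LinearMap.mulLeft_apply]
  · rw [← mul_assoc, ← (commute_incl_genT n u).eq, mul_assoc, ← pow_succ']
    exact .framing _ _
  · subst hn
    have h1 : genT d q (Fin.last (i + 1)) * genG d q i hi =
        genG d q i hi * incl d (i + 1) q (genT d q (Fin.last i)) := by
      rw [incl_genT]
      exact (genG_mul_genT_left i hi).symm
    rw [← mul_assoc, ← mul_assoc, ← (commute_incl_genT (i + 1) u).eq,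
      mul_assoc (incl d (i + 1) q u), h1, ← mul_assoc, mul_assoc _ _ (incl d (i + 1) q v),
      ← map_mul]
    exact .braiding _ _ _ _ rfl

theorem genT_last_pow_mul_mem {n : ℕ} (s : ℕ) {y : YHAlgebra d (n + 1) q}
    (hy : y ∈ Submodule.span ℂ {y | InductiveGen d n q y}) :
    genT d q (Fin.last n) ^ s * y ∈ Submodule.span ℂ {y | InductiveGen d n q y} := by
  induction s with
  | zero => rwa [pow_zero, one_mul]
  | succ s ih =>
    rw [pow_succ', mul_assoc]
    exact genT_last_mul_mem ih

/-- The span of the `u t_{n+1}^s` and the `u g_n v` is everything as soon as it contains the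
elements `g_n u g_n`. -/
theorem span_inductiveGen_of {n : ℕ}
    (H : ∀ i (hn : i + 1 = n) (u : YHAlgebra d n q),
      genG d q i (by omega) * incl d n q u * genG d q i (by omega) ∈
        Submodule.span ℂ {y | InductiveGen d n q y}) :
    Submodule.span ℂ {y | InductiveGen d n q y} = ⊤ := by
  set M := Submodule.span ℂ {y | InductiveGen d n q y} with hM
  -- The left stabilizer of `M` is a subalgebra. Once it contains the generators it is everything,
  -- and applying it to 1 ∈ `M` gives `M` = ⊤.
  let S : Subalgebra ℂ (YHAlgebra d (n + 1) q) :=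
    { carrier := {y | ∀ z ∈ M, y * z ∈ M}
      mul_mem' := fun {a b} ha hb z hz => by rw [mul_assoc]; exact ha _ (hb _ hz)
      add_mem' := fun {a b} ha hb z hz => by rw [add_mul]; exact M.add_mem (ha _ hz) (hb _ hz)
      algebraMap_mem' := fun c z hz => by rw [← Algebra.smul_def]; exact M.smul_mem c hz }
  refine eq_top_iff.mpr fun y _ => ?_
  have hy : y ∈ S := by
    refine mem_of_generators_mem S (fun i hi => ?_) (fun j => ?_) y
    · by_cases hn : i + 1 = n
      · change M ≤ M.comap (LinearMap.mulLeft ℂ (genG d q i hi))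
        rw [hM, Submodule.span_le]
        rintro _ (⟨u, s⟩ | ⟨u, v, k, hk, hkn⟩) <;>
          simp only [SetLike.mem_coe, Submodule.mem_comap, LinearMap.mulLeft_apply]
        -- Here g u t_{n+1}^s = g t_{n+1}^s u = t_n^s g u, which is again of braiding type.
        · subst hn
          have h1 : SemiconjBy (genG d q i hi) (genT d q (Fin.last (i + 1)))
              (incl d (i + 1) q (genT d q (Fin.last i))) := by
            rw [incl_genT]
            exact genG_mul_genT_right i hi
          rw [((commute_incl_genT (i + 1) u).pow_right s).eq, ← mul_assoc, (h1.pow_right s).eq,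
            ← map_pow]
          exact Submodule.subset_span (.braiding _ _ _ _ rfl)
        -- The only case that needs `H`: the product g u g v contains the last crossing twice.
        · obtain rfl : k = i := by omega
          rw [← mul_assoc, ← mul_assoc]
          exact mul_incl_mem v (H k hn u)
      -- Any earlier crossing comes from the algebra on n strands, so bimodule stability applies.
      · intro z hz
        rw [← incl_genG i (by omega)]
        exact incl_mul_mem _ hz
    · induction j using Fin.lastCases with
      | last => exact fun z hz => genT_last_mul_mem hz
      | cast j =>
        intro z hz
        rw [← incl_genT]
        exact incl_mul_mem _ hz
  rw [← mul_one y]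
  exact hy 1 one_mem_span_inductiveGen

/-- The elements `u t_{n+1}^s` and `u g_n v` with `u, v` in `Y_{d,n}(q)` span `Y_{d,n+1}(q)`. -/
theorem span_inductiveGen (n : ℕ) : Submodule.span ℂ {y | InductiveGen d n q y} = ⊤ := by
  induction n with
  -- On a single strand there is no crossing, so the hypothesis is vacuous.
  | zero => exact span_inductiveGen_of (by omega)
  | succ n ih =>
    refine span_inductiveGen_of fun i hn u => ?_
    obtain rfl : i = n := by omega
    have hu : u ∈ Submodule.span ℂ {y | InductiveGen d i q y} := ih ▸ Submodule.mem_top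
    set M := Submodule.span ℂ {y | InductiveGen d (i + 1) q y} with hM
    have hIM : ∀ w, ∀ y ∈ M, incl d (i + 1) q w * y ∈ M := fun w y hy => incl_mul_mem w hy
    have hTM : ∀ s, ∀ y ∈ M, genT d q (Fin.last (i + 1)) ^ s * y ∈ M :=
      fun s y hy => genT_last_pow_mul_mem s hy
    have h1 : (1 : YHAlgebra d (i + 1 + 1) q) ∈ M := one_mem_span_inductiveGen
    have hg : genG d q i (by omega) ∈ M := by
      have := Submodule.subset_span (R := ℂ) (s := {y | InductiveGen d (i + 1) q y})
        (InductiveGen.braiding 1 1 i (by omega) rfl)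
      rwa [map_one, one_mul, mul_one] at this
    induction hu using Submodule.span_induction with
    | zero => rw [map_zero, mul_zero, zero_mul]; exact M.zero_mem
    | add y z _ _ hy hz => rw [map_add, mul_add, add_mul]; exact M.add_mem hy hz
    | smul c y _ hy => rw [map_smul, mul_smul_comm, smul_mul_assoc]; exact M.smul_mem c hy
    | mem y hy =>
      cases hy with
      -- The factor u commutes with g, so g u t_n^s g = u t_{n+1}^s g². The quadratic relation
      -- replaces g² by 1 + (q - q⁻¹) e g, and e is a polynomial in the last two framings, under
      -- which the span is stable.
      | framing u s =>
        have h2 : SemiconjBy (genG d q i (by omega)) (incl d (i + 1) q (genT d q (Fin.last i)))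
            (genT d q (Fin.last (i + 1))) := by
          rw [incl_genT]
          exact genG_mul_genT_left i (by omega)
        rw [map_mul, map_pow, ← mul_assoc, ← (commute_incl_incl_genG i u).eq, mul_assoc, mul_assoc,
          ← mul_assoc (genG d q i _), (h2.pow_right s).eq, mul_assoc, genG_mul_self]
        refine hIM _ _ (hTM _ _ (M.add_mem h1 (M.smul_mem _ ?_)))
        rw [genE_eq, smul_mul_assoc, Finset.sum_mul]
        refine M.smul_mem _ (M.sum_mem fun a _ => ?_)
        have h3 : genT d q (⟨i, by omega⟩ : Fin (i + 1 + 1)) =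
            incl d (i + 1) q (genT d q (Fin.last i)) := by rw [incl_genT]; rfl
        rw [mul_assoc, h3, ← map_pow]
        exact hIM _ _ (hTM _ _ hg)
      -- Here u and v commute with the new crossing, so the braid relation turns g_{k+1} (u g_k v)
      -- g_{k+1} into (u g_k) g_{k+1} (g_k v), a single spanning element.
      | braiding u v k hk hn =>
        subst hn
        have h2 : genG d q (k + 1) (by omega) * incl d (k + 1 + 1) q (genG d q k (by omega)) *
            genG d q (k + 1) (by omega) = incl d (k + 1 + 1) q (genG d q k (by omega)) *
            genG d q (k + 1) (by omega) * incl d (k + 1 + 1) q (genG d q k (by omega)) := by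
          rw [incl_genG]
          exact genG_braid k (by omega)
        have h3 := (commute_incl_incl_genG (k + 1) u).eq
        have h4 := (commute_incl_incl_genG (k + 1) v).eq
        have h5 : genG d q (k + 1) (by omega) * incl d (k + 1 + 1) q
            (incl d (k + 1) q u * genG d q k (by omega) * incl d (k + 1) q v) *
            genG d q (k + 1) (by omega) =
            incl d (k + 1 + 1) q (incl d (k + 1) q u * genG d q k (by omega)) *
            genG d q (k + 1) (by omega) *
            incl d (k + 1 + 1) q (genG d q k (by omega) * incl d (k + 1) q v) := by
          simp only [map_mul]
          generalize genG d q (k + 1) _ = g at *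
          calc g * (incl d _ q (incl d _ q u) * incl d _ q (genG d q k (by omega)) *
                incl d _ q (incl d _ q v)) * g
              = (g * incl d _ q (incl d _ q u)) * incl d _ q (genG d q k (by omega)) *
                (incl d _ q (incl d _ q v) * g) := by simp only [mul_assoc]
            _ = incl d _ q (incl d _ q u) * (g * incl d _ q (genG d q k (by omega)) * g) *
                incl d _ q (incl d _ q v) := by rw [← h3, h4]; simp only [mul_assoc]
            _ = _ := by rw [h2]; simp only [mul_assoc]
        rw [h5]
        exact Submodule.subset_span (InductiveGen.braiding _ _ _ _ rfl)

/-- Induction along the inductive spanning set of `Y_{d,n+1}(q)`. -/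
theorem inductiveGen_induction {n : ℕ} {P : YHAlgebra d (n + 1) q → Prop}
    (add : ∀ y z, P y → P z → P (y + z)) (smul : ∀ (c : ℂ) y, P y → P (c • y))
    (framing : ∀ u s, P (incl d n q u * genT d q (Fin.last n) ^ s))
    (braiding : ∀ u v i (hi : i + 1 < n + 1), i + 1 = n →
      P (incl d n q u * genG d q i hi * incl d n q v)) (y : YHAlgebra d (n + 1) q) : P y := by
  have hy : y ∈ Submodule.span ℂ {y | InductiveGen d n q y} :=
    span_inductiveGen (d := d) (q := q) n ▸ Submodule.mem_top
  induction hy using Submodule.span_induction with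
  -- Zero is a scalar multiple of a spanning element, so `P` needs no separate hypothesis for it.
  | zero => simpa using smul 0 _ (framing 0 0)
  | add y z _ _ hy hz => exact add y z hy hz
  | smul c y _ hy => exact smul c y hy
  | mem y hy =>
    cases hy with
    | framing u s => exact framing u s
    | braiding u v i hi hn => exact braiding u v i hi hn

end Spanning

/-! ### Multiplicativity of the trace -/

section Trace

variable {d : ℕ} [NeZero d] {q : ℂ} {x : ZMod d → ℂ}
  {tr : ∀ n : ℕ, YHAlgebra d n q →ₗ[ℂ] Polynomial ℂ}

/-- Both sides depend on s only modulo d. The residue 0, which the framing rule leaves out, is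
compatibility with the inclusion together with x_0 = 1. -/
theorem IsMarkovTrace.framing_pow (h : IsMarkovTrace d q x tr) (hx : x 0 = 1) (n : ℕ)
    (a : YHAlgebra d n q) (s : ℕ) :
    tr (n + 1) (incl d n q a * genT d q (Fin.last n) ^ s) = Polynomial.C (x s) * tr n a := by
  rw [pow_eq_pow_mod s (genT_pow_card (Fin.last n)), ← ZMod.natCast_mod s d]
  have hs : s % d < d := Nat.mod_lt _ (NeZero.pos d)
  generalize s % d = r at hs ⊢
  rcases Nat.eq_zero_or_pos r with rfl | hr
  · rw [pow_zero, mul_one, h.compat, Nat.cast_zero, hx, map_one, one_mul]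
  · exact h.framing n a r hr (by omega)

/-- Cyclicity: tr(u g v) = tr(v u g), and the Markov rule now applies to v u. This form fits the
spanning elements. -/
theorem IsMarkovTrace.braiding (h : IsMarkovTrace d q x tr) {n : ℕ} (u v : YHAlgebra d n q)
    {i : ℕ} (hi : i + 1 < n + 1) (hn : i + 1 = n) :
    tr (n + 1) (incl d n q u * genG d q i hi * incl d n q v) = Polynomial.X * tr n (u * v) := by
  subst hn
  rw [h.comm, ← mul_assoc, ← map_mul, h.markov, h.comm]

/-- Each strand is the last one of some smaller algebra, where the framing rule can be read off. -/
theorem IsMarkovTrace.genT_pow (h : IsMarkovTrace d q x tr) (hx : x 0 = 1) {n : ℕ} (j : Fin n)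
    (s : ℕ) : tr n (genT d q j ^ s) = Polynomial.C (x s) := by
  induction n with
  | zero => exact j.elim0
  | succ n ih =>
    induction j using Fin.lastCases with
    | last => simpa only [map_one, one_mul, h.one, mul_one] using h.framing_pow hx n 1 s
    | cast j => rw [← incl_genT, ← map_pow, h.compat, ih]

/-- If `k ↦ x_k` is multiplicative, then the trace is multiplicative in every framing. -/
theorem IsMarkovTrace.mul_genT (h : IsMarkovTrace d q x tr) (hx : ∀ s : ℕ, x s = x 1 ^ s) {n : ℕ}
    (a : YHAlgebra d n q) (j : Fin n) :
    tr n (a * genT d q j) = Polynomial.C (x 1) * tr n a := by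
  have hx0 : x 0 = 1 := by simpa using hx 0
  induction n with
  | zero => exact j.elim0
  | succ n ih =>
    induction a using inductiveGen_induction with
    | add y z hy hz => rw [add_mul, map_add, hy, hz, map_add, mul_add]
    | smul c y hy => rw [smul_mul_assoc, map_smul, hy, map_smul, mul_smul_comm]
    | framing u s =>
      induction j using Fin.lastCases with
      -- The character property enters here: two framings meet on the last strand, and x_{s+1} = x_1
      -- x_s.
      | last =>
        rw [mul_assoc, ← pow_succ, h.framing_pow hx0, h.framing_pow hx0, hx, hx s, pow_succ',
          map_mul, mul_assoc]
      | cast j =>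
        rw [← incl_genT, mul_assoc, ← ((commute_incl_genT n (genT d q j)).pow_right s).eq,
          ← mul_assoc, ← map_mul, h.framing_pow hx0, h.framing_pow hx0, ih, mul_left_comm]
    | braiding u v i hi hn =>
      induction j using Fin.lastCases with
      | last =>
        -- Moved past v and through g, the framing lands on the previous strand: u g v t_{n+1} = u
        -- t_n g v. The braiding rule leaves tr(u t_n v), and cyclicity puts t_n at the end, ready
        -- for the hypothesis on fewer strands.
        subst hn
        have h1 : genG d q i hi * genT d q (Fin.last (i + 1)) =
            incl d (i + 1) q (genT d q (Fin.last i)) * genG d q i hi := by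
          rw [incl_genT]
          exact genG_mul_genT_right i hi
        rw [mul_assoc, (commute_incl_genT (i + 1) v).eq, ← mul_assoc, mul_assoc _ (genG d q i hi),
          h1, ← mul_assoc, ← map_mul, h.braiding _ _ hi rfl, h.braiding _ _ hi rfl, h.comm,
          ← mul_assoc, ih, h.comm, mul_left_comm]
      | cast j =>
        rw [← incl_genT, mul_assoc, ← map_mul, h.braiding _ _ hi hn, h.braiding _ _ hi hn,
          ← mul_assoc, ih, mul_left_comm]

theorem IsMarkovTrace.mul_genT_pow (h : IsMarkovTrace d q x tr) (hx : ∀ s : ℕ, x s = x 1 ^ s)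
    {n : ℕ} (a : YHAlgebra d n q) (j : Fin n) (s : ℕ) :
    tr n (a * genT d q j ^ s) = Polynomial.C (x s) * tr n a := by
  rw [hx]
  induction s with
  | zero => simp
  | succ s ih => rw [pow_succ, ← mul_assoc, h.mul_genT hx, ih, pow_succ', map_mul, mul_assoc]

/-- Induction on the strands of the second factor. The inductive step consists of rules valid for
every Markov trace with x_0 = 1; the character property is needed only for m = 0, where b lies
entirely on the shared strand. -/
theorem IsMarkovTrace.shiftYH_mul (h : IsMarkovTrace d q x tr) (hx : ∀ s : ℕ, x s = x 1 ^ s)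
    {n m : ℕ} (a : YHAlgebra d (n + 1) q) (b : YHAlgebra d (m + 1) q) :
    tr (n + m + 1) (shiftYH d q 0 (by omega) a * shiftYH d q n (by omega) b) =
      tr (n + 1) a * tr (m + 1) b := by
  have hx0 : x 0 = 1 := by simpa using hx 0
  induction m with
  | zero =>
    have h0 : shiftYH d q 0 (by omega : 0 + (n + 1) ≤ n + 0 + 1) a = a := shiftYH_zero_self a
    rw [h0]
    induction b using inductiveGen_induction with
    | add y z hy hz => rw [map_add, mul_add, map_add, hy, hz, map_add, mul_add]
    | smul c y hy => rw [map_smul, mul_smul_comm, map_smul, hy, map_smul, mul_smul_comm]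
    | framing u s =>
      -- The algebra on zero strands has no generators, so u is a scalar and b is a multiple of a
      -- power of the framing.
      obtain ⟨c, rfl⟩ := Algebra.mem_bot.mp (mem_of_generators_mem (⊥ : Subalgebra ℂ _)
        (fun i hi => absurd hi (by omega)) (fun j => j.elim0) u)
      rw [h.framing_pow hx0, map_mul (shiftYH d q n _), AlgHom.commutes, AlgHom.commutes,
        map_pow, shiftYH_genT,
        Algebra.algebraMap_eq_smul_one, Algebra.algebraMap_eq_smul_one, smul_mul_assoc, one_mul,
        mul_smul_comm, map_smul, h.mul_genT_pow hx, map_smul, h.one, mul_smul_comm, mul_smul_comm,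
        mul_one, mul_comm]
    | braiding u v i hi hn => omega
  | succ m ih =>
    have h0 : shiftYH d q 0 (by omega : 0 + (n + 1) ≤ n + (m + 1) + 1) a =
        incl d (n + m + 1) q (shiftYH d q 0 (by omega) a) := shiftYH_zero_succ (by omega) a
    have hb : ∀ u : YHAlgebra d (m + 1) q,
        shiftYH d q n (by omega : n + (m + 1 + 1) ≤ n + (m + 1) + 1) (incl d (m + 1) q u) =
        incl d (n + m + 1) q (shiftYH d q n (by omega) u) := shiftYH_incl n (by omega)
    rw [h0]
    induction b using inductiveGen_induction with
    | add y z hy hz => rw [map_add, mul_add, map_add, hy, hz, map_add, mul_add]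
    | smul c y hy => rw [map_smul, mul_smul_comm, map_smul, hy, map_smul, mul_smul_comm]
    | framing u s =>
      rw [h.framing_pow hx0, map_mul (shiftYH d q n _), map_pow (shiftYH d q n _), hb,
        shiftYH_genT, ← mul_assoc, ← map_mul]
      -- Strand m + 1 of the second factor is shifted to n + (m + 1), by definition the last of the
      -- (n + m + 1) + 1 strands. The framing rule thus applies with the first factor as part of the
      -- coefficient.
      refine (h.framing_pow hx0 (n + m + 1) _ s).trans ?_
      rw [ih, mul_left_comm]
    | braiding u v i hi hn =>
      rw [h.braiding _ _ hi hn, map_mul (shiftYH d q n _), map_mul (shiftYH d q n _), hb, hb,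
        shiftYH_genG, ← mul_assoc, ← mul_assoc,
        ← map_mul]
      -- Likewise the last crossing of the second factor is the last crossing of the whole; the
      -- product of the first factor with the shifted u plays the role of the left coefficient.
      refine (h.braiding (n := n + m + 1) _ _ (by omega) (by omega)).trans ?_
      rw [mul_assoc, ← map_mul, ih, mul_left_comm]

end Trace

end YokonumaHecke

end

/-! ### The equivalence. -/

theorem mainTheorem9 (d : ℕ) [NeZero d] (q : ℂ) (hq : q ≠ 0) (x : ZMod d → ℂ)
    (hx : YokonumaHecke.IsESystemSolution d x) (n m : ℕ) :
    (∀ (α : YokonumaHecke.FramedBraidGroup (n + 1)) (β : YokonumaHecke.FramedBraidGroup (m + 1)),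
      YokonumaHecke.specializedTrace d q x (n + m + 1)
          (YokonumaHecke.braidToYH d q (YokonumaHecke.connectedSum α β)) =
        YokonumaHecke.specializedTrace d q x (n + 1) (YokonumaHecke.braidToYH d q α) *
          YokonumaHecke.specializedTrace d q x (m + 1) (YokonumaHecke.braidToYH d q β)) ↔
      (x 1 ^ d = 1 ∧ ∀ k : ℕ, 1 ≤ k → k ≤ d - 1 → x k = x 1 ^ k) := by
  have h := YokonumaHecke.specializedTrace_spec d q x
  constructor
  · intro H
    have hadd : ∀ a b : ℕ, x (a + b : ℕ) = x a * x b := by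
      intro a b
      -- Both framings land on the shared strand n, so the connected sum maps to the power a + b of
      -- one framing generator.
      have := H (PresentedGroup.of (.t (Fin.last n)) ^ a) (PresentedGroup.of (.t 0) ^ b)
      have hα : YokonumaHecke.braidToYH d q
          (PresentedGroup.of (.t (Fin.last n)) ^ a : YokonumaHecke.FramedBraidGroup (n + 1)) =
          YokonumaHecke.genT d q (Fin.last n) ^ a := YokonumaHecke.braidToYH_t_pow _ _
      have hβ : YokonumaHecke.braidToYH d q
          (PresentedGroup.of (.t 0) ^ b : YokonumaHecke.FramedBraidGroup (m + 1)) =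
          YokonumaHecke.genT d q 0 ^ b := YokonumaHecke.braidToYH_t_pow _ _
      rw [YokonumaHecke.braidToYH_connectedSum, hα, hβ, h.genT_pow hx.1, h.genT_pow hx.1, map_pow,
        map_pow, YokonumaHecke.shiftYH_genT, YokonumaHecke.shiftYH_genT] at this
      simp only [Fin.val_last, Fin.val_zero, zero_add, add_zero] at this
      rw [← pow_add, h.genT_pow hx.1, ← map_mul] at this
      exact Polynomial.C_injective this
    have hpow : ∀ k : ℕ, x k = x 1 ^ k := by
      intro k
      induction k with
      | zero => simpa using hx.1
      | succ k ih => rw [hadd, ih, Nat.cast_one, pow_succ]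
    refine ⟨?_, fun k _ _ => hpow k⟩
    -- The power formula at k = d, whose class in ℤ/dℤ is 0.
    rw [← hpow, ZMod.natCast_self, hx.1]
  · rintro ⟨hd, hk⟩ α β
    -- Both sides are d-periodic in s, the right one because x_1^d = 1; this extends the formula
    -- from 1 ≤ k ≤ d - 1 to all natural exponents.
    have hpow : ∀ s : ℕ, x s = x 1 ^ s := by
      intro s
      rw [pow_eq_pow_mod s hd, ← ZMod.natCast_mod s d]
      have hs : s % d < d := Nat.mod_lt _ (NeZero.pos d)
      generalize s % d = r at hs ⊢
      rcases Nat.eq_zero_or_pos r with rfl | hr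
      · simpa using hx.1
      · exact hk r hr (by omega)
    rw [YokonumaHecke.braidToYH_connectedSum]
    exact h.shiftYH_mul hpow _ _
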